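/- A continuum is a non-empty compact connected metric space; it is non-degenerate if it has more than one point. A continuum $X$ is chainable if for every $\varepsilon>0$ there are finitely many open sets $L_1,\dots,L_n$ of diameter less than $\varepsilon$ that cover $X$ and satisfy $L_i\cap L_j\neq\emptyset$ if and only if $|i-j|\le 1$. An $\varepsilon$-mapping is a continuous map $f$ on $X$ such that $\operatorname{diam} f^{-1}(y)<\varepsilon$ for every point $y$ of its codomain. A dendrite is a locally connected continuum that contains no simple closed curve. A tree is a continuum that contains no simple closed curve and is a union of finitely many arcs, any two of which meet at most in common end points. Let $X$ be a non-degenerate chainable continuum. Then: (i) for every non-degenerate dendrite $D$ and every $\varepsilon>0$ there is an $\varepsilon$-mapping of $X$ onto $D$; (ii) for every tree $T$ there are continuous surjections $f_n\colon T\to T$ ($n=0,1,2,\dots$) such that $X$ is homeomorphic to the inverse limit $$\varprojlim(T,f_n)=\Big\{(x_n)_{n\ge 0}\in\prod_{n\ge0}T : f_n(x_{n+1})=x_n\text{ for all } n\Big\}.$$ -/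

import Mathlib

universe u v w

namespace Continua

/-- A chain in `X`: an indexed family `L 0, …, L (n - 1)` of sets in which two links meet exactly
when their indices differ by at most one (in particular every link is nonempty). -/
def IsLinearChain {X : Type u} {n : ℕ} (L : Fin n → Set X) : Prop :=
  ∀ i j : Fin n, (L i ∩ L j).Nonempty ↔ ((i : ℕ) ≤ (j : ℕ) + 1 ∧ (j : ℕ) ≤ (i : ℕ) + 1)

/-- `X` is chainable: for every `ε > 0` it is covered by a finite chain of open sets of diameter
less than `ε`. (Used for compact `X`, where all diameters are finite.) -/
def IsChainable (X : Type u) [MetricSpace X] : Prop :=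
  ∀ ε : ℝ, 0 < ε → ∃ (n : ℕ) (L : Fin n → Set X),
    IsLinearChain L ∧ (∀ i, IsOpen (L i)) ∧ (∀ i, Metric.diam (L i) < ε) ∧ ⋃ i, L i = Set.univ

/-- `f` is an `ε`-mapping: continuous, with all point inverses of diameter less than `ε`.
(Used for compact `X`, where all diameters are finite.) -/
def IsEpsMapping {X : Type u} {Y : Type v} [MetricSpace X] [TopologicalSpace Y]
    (ε : ℝ) (f : X → Y) : Prop :=
  Continuous f ∧ ∀ y, Metric.diam (f ⁻¹' {y}) < ε

/-- `Y` contains a simple closed curve, that is, a homeomorphic copy of the circle (a continuous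
injection of the compact circle into a Hausdorff space is an embedding). -/
def HasSimpleClosedCurve (Y : Type u) [TopologicalSpace Y] : Prop :=
  ∃ γ : Circle → Y, Continuous γ ∧ Function.Injective γ

/-- A dendrite: a locally connected metric continuum that contains no simple closed curve. -/
structure IsDendrite (D : Type u) [MetricSpace D] : Prop where
  compact : CompactSpace D
  connected : ConnectedSpace D
  locallyConnected : LocallyConnectedSpace D
  acyclic : ¬ HasSimpleClosedCurve D

/-- `T` is the union of finitely many arcs, any two of which meet at most in common end points. -/
def IsFiniteUnionOfArcs (T : Type u) [TopologicalSpace T] : Prop :=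
  ∃ (n : ℕ) (γ : Fin n → unitInterval → T),
    (∀ i, Continuous (γ i) ∧ Function.Injective (γ i)) ∧
    (⋃ i, Set.range (γ i)) = Set.univ ∧
    ∀ i j, i ≠ j →
      Set.range (γ i) ∩ Set.range (γ j) ⊆ {γ i 0, γ i 1} ∩ {γ j 0, γ j 1}

/-- A (topological) tree: a connected finite graph that contains no simple closed curve.
Compactness is automatic, and so is non-degeneracy. -/
structure IsTopologicalTree (T : Type u) [MetricSpace T] : Prop where
  connected : ConnectedSpace T
  graph : IsFiniteUnionOfArcs T
  acyclic : ¬ HasSimpleClosedCurve T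

/-- The inverse limit of an inverse sequence `P 0 ← P 1 ← P 2 ← ⋯` with bonding maps
`f n : P (n + 1) → P n`, as a subspace of the product. -/
def InverseLimit (P : ℕ → Type u) [∀ n, TopologicalSpace (P n)] (f : ∀ n, C(P (n + 1), P n)) :
    Type u :=
  {x : ∀ n, P n // ∀ n, f n (x (n + 1)) = x n}

instance (P : ℕ → Type u) [∀ n, TopologicalSpace (P n)] (f : ∀ n, C(P (n + 1), P n)) :
    TopologicalSpace (InverseLimit P f) :=
  inferInstanceAs (TopologicalSpace {x : ∀ n, P n // ∀ n, f n (x (n + 1)) = x n})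

end Continua

namespace Continua

/-! Everything passes through the interval. A non-degenerate dendrite `D` has a map `φ` onto `[0,
1]` with approximate right inverses: for each `δ > 0` some `f` maps `[0, 1]` onto `D` with `φ ∘ f`
within `δ` of the identity (`IsDendrite.exists_approx_sections`). Here `φ` is the first-point
retraction onto an arc, and `f` moves along that arc while sweeping out the preimages of short
intervals, which are connected. The sweeping uses covering paths (`exists_path_covering`). The
retraction uses that interior points of an arc separate its ends: otherwise a path around such a
point would contain an arc, and two arcs with common ends would yield a simple closed curve.

A chainable `X` has maps `g` onto `[0, 1]` with arbitrarily small fibres. If `f (g x) = f (g y)`,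
then `g x` and `g y` are `2δ`-close, which for small `δ` makes `x` and `y` close; so `f ∘ g` proves
(i).

For (ii), `g` is approximately `h₀ ∘ g'` with `h₀` onto, for every `g'` with fine enough fibres
(`exists_approx_factorization`). Hence `f ∘ g` is close to `(f ∘ h₀ ∘ φ) ∘ (f' ∘ g')`, and `f ∘ h₀ ∘
φ` is a self-surjection of `D`. Iterating with rapidly decreasing errors gives an inverse sequence
with limit `X` (`exists_homeomorph_inverseLimit`). This works for all non-degenerate dendrites, and
trees are such. -/

open Set Filter Topology

/-! ### Covering paths in locally connected complete spaces -/

/-- `x` and `y` are joined by an infinite sequence of members of `𝓑`, consecutive ones meeting, that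
starts at `x`, runs through all members of `𝓦`, and finally stays around `y`. -/
def LinkedThrough {D : Type*} (𝓑 𝓦 : Set (Set D)) (x y : D) : Prop :=
  ∃ V : ℕ → Set D, (∀ i, V i ∈ 𝓑) ∧ (∀ i, (V i ∩ V (i + 1)).Nonempty) ∧ x ∈ V 0 ∧
    (∀ᶠ i in atTop, y ∈ V i) ∧ ∀ᶠ m in atTop, ∀ W ∈ 𝓦, ∃ i < m, V i = W

lemma LinkedThrough.of_mem {D : Type*} {𝓑 : Set (Set D)} {B : Set D} (hB : B ∈ 𝓑) {x y : D}
    (hx : x ∈ B) (hy : y ∈ B) : LinkedThrough 𝓑 {B} x y := by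
  refine ⟨fun _ => B, fun _ => hB, fun _ => ⟨x, hx, hx⟩, hx, .of_forall fun _ => hy, ?_⟩
  filter_upwards [eventually_gt_atTop 0] with m hm W hW
  exact ⟨0, hm, by simpa using hW.symm⟩

lemma LinkedThrough.mono {D : Type*} {𝓑 𝓦 𝓦' : Set (Set D)} {x y : D}
    (h : LinkedThrough 𝓑 𝓦 x y) (h' : 𝓦' ⊆ 𝓦) : LinkedThrough 𝓑 𝓦' x y := by
  obtain ⟨V, h1, h2, h3, h4, h5⟩ := h
  exact ⟨V, h1, h2, h3, h4, h5.mono fun m hm W hW => hm W (h' hW)⟩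

lemma LinkedThrough.trans {D : Type*} {𝓑 𝓦 𝓦' : Set (Set D)} {x y z : D}
    (h : LinkedThrough 𝓑 𝓦 x y) (h' : LinkedThrough 𝓑 𝓦' y z) :
    LinkedThrough 𝓑 (𝓦 ∪ 𝓦') x z := by
  obtain ⟨V, h1, h2, h3, h4, h5⟩ := h
  obtain ⟨V', h1', h2', h3', h4', h5'⟩ := h'
  obtain ⟨m, hm4, hm5, hm0⟩ := ((tendsto_sub_atTop_nat 1).eventually h4 |>.and
    (h5.and (eventually_gt_atTop 0))).exists
  refine ⟨fun i => if i < m then V i else V' (i - m), ?_, ?_, ?_, ?_, ?_⟩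
  · intro i
    by_cases hi : i < m <;> simp [hi, h1, h1']
  · intro i
    rcases lt_trichotomy (i + 1) m with hi | hi | hi
    · simpa [hi, (Nat.lt_succ_self i).trans hi] using h2 i
    · have hi' : i < m := by omega
      have : i = m - 1 := by omega
      simp only [hi', if_true, hi, lt_irrefl, if_false, Nat.sub_self]
      exact ⟨y, by rw [this]; exact hm4, h3'⟩
    · have hi1 : ¬ i < m := by omega
      have hi2 : ¬ i + 1 < m := by omega
      simp only [hi1, hi2, if_false]
      rw [show i + 1 - m = (i - m) + 1 by omega]
      exact h2' _
  · simpa [hm0] using h3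
  · filter_upwards [(tendsto_sub_atTop_nat m).eventually h4', eventually_ge_atTop m] with i hi hmi
    simpa [hmi.not_gt] using hi
  · filter_upwards [(tendsto_sub_atTop_nat m).eventually h5', eventually_ge_atTop m] with k hk hmk W hW
    rcases hW with hW | hW
    · obtain ⟨i, hi, rfl⟩ := hm5 W hW
      exact ⟨i, hi.trans_le hmk, by simp [hi]⟩
    · obtain ⟨i, hi, rfl⟩ := hk W hW
      exact ⟨i + m, by omega, by simp⟩

/-- A member of `𝓑` containing one reachable point has all its points reachable. So the members with
a reachable point and those with an unreachable one have disjoint open unions, which would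
disconnect `S`. -/
lemma IsPreconnected.linkedThrough_empty {D : Type*} [TopologicalSpace D] {S : Set D}
    (hS : IsPreconnected S) {𝓑 : Set (Set D)} (hopen : ∀ B ∈ 𝓑, IsOpen B)
    (hcov : ∀ p ∈ S, ∃ B ∈ 𝓑, p ∈ B) {x y : D} (hx : x ∈ S) (hy : y ∈ S) :
    LinkedThrough 𝓑 ∅ x y := by
  by_contra hxy
  let A : Set D := ⋃₀ {B ∈ 𝓑 | ∃ z ∈ B, LinkedThrough 𝓑 ∅ x z}
  let A' : Set D := ⋃₀ {B ∈ 𝓑 | ∃ z ∈ B, ¬ LinkedThrough 𝓑 ∅ x z}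
  have hA : ∀ z ∈ A, LinkedThrough 𝓑 ∅ x z := by
    rintro z ⟨B, ⟨hB, w, hw, hl⟩, hz⟩
    exact (hl.trans (.of_mem hB hw hz)).mono (empty_subset _)
  have hA' : ∀ z ∈ A', ¬ LinkedThrough 𝓑 ∅ x z := by
    rintro z ⟨B, ⟨hB, w, hw, hl⟩, hz⟩ h
    exact hl ((h.trans (.of_mem hB hz hw)).mono (empty_subset _))
  have hxx : LinkedThrough 𝓑 ∅ x x := by
    obtain ⟨B, hB, hp⟩ := hcov x hx
    exact (LinkedThrough.of_mem hB hp hp).mono (empty_subset _)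
  obtain ⟨z, -, hz, hz'⟩ := hS A A' (isOpen_sUnion fun B hB => hopen B hB.1)
    (isOpen_sUnion fun B hB => hopen B hB.1)
    (fun p hp => by
      obtain ⟨B, hB, hpB⟩ := hcov p hp
      by_cases h : LinkedThrough 𝓑 ∅ x p
      · exact .inl ⟨B, ⟨hB, p, hpB, h⟩, hpB⟩
      · exact .inr ⟨B, ⟨hB, p, hpB, h⟩, hpB⟩)
    (by
      obtain ⟨B, hB, hpB⟩ := hcov x hx
      exact ⟨x, hx, B, ⟨hB, x, hpB, hxx⟩, hpB⟩)
    (by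
      obtain ⟨B, hB, hpB⟩ := hcov y hy
      exact ⟨y, hy, B, ⟨hB, y, hpB, hxy⟩, hpB⟩)
  exact hA' z hz' (hA z hz)

lemma IsPreconnected.linkedThrough {D : Type*} [TopologicalSpace D] {S : Set D}
    (hS : IsPreconnected S) {𝓑 𝓦 : Set (Set D)} (hopen : ∀ B ∈ 𝓑, IsOpen B)
    (hcov : ∀ p ∈ S, ∃ B ∈ 𝓑, p ∈ B) (hW : 𝓦.Finite) (hWB : 𝓦 ⊆ 𝓑)
    (hWS : ∀ W ∈ 𝓦, (W ∩ S).Nonempty) {x y : D} (hx : x ∈ S) (hy : y ∈ S) :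
    LinkedThrough 𝓑 𝓦 x y := by
  induction 𝓦, hW using Set.Finite.induction_on generalizing x with
  | empty => exact IsPreconnected.linkedThrough_empty hS hopen hcov hx hy
  | @insert W 𝓦 _ _ ih =>
    obtain ⟨w, hw, hwS⟩ := hWS W (mem_insert _ _)
    have h1 := IsPreconnected.linkedThrough_empty hS hopen hcov hx hwS
    have h2 := LinkedThrough.of_mem (hWB (mem_insert _ _)) hw hw
    have h3 := ih (fun V hV => hWB (mem_insert_of_mem _ hV))
      (fun V hV => hWS V (mem_insert_of_mem _ hV)) hwS
    exact ((h1.trans h2).trans h3).mono (by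
      intro V hV
      rcases hV with rfl | hV <;> simp_all)

/-- The first `M` members of `V` form a sequence of connected open sets from `x` to `y`, consecutive
ones meeting, that covers `K`. -/
structure IsLinkedCover {D : Type*} [TopologicalSpace D] (K : Set D) (x y : D) (M : ℕ)
    (V : ℕ → Set D) : Prop where
  pos : 0 < M
  isOpen : ∀ i < M, IsOpen (V i)
  isPreconnected : ∀ i < M, IsPreconnected (V i)
  nonempty : ∀ i < M, (V i).Nonempty
  inter : ∀ i, i + 1 < M → (V i ∩ V (i + 1)).Nonempty
  left_mem : x ∈ V 0
  right_mem : y ∈ V (M - 1)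
  cover : ∀ k ∈ K, ∃ i < M, k ∈ V i

/-- Each `V i` is connected, so small connected sets inside it can be strung from a point of `V (i -
1) ∩ V i` to a point of `V i ∩ V (i + 1)`, passing through all sets needed to cover `K`. All blocks
get the same length `m`, so that the parent of link `j` is `j / m`, as for subdivision into equal
intervals. -/
lemma IsLinkedCover.exists_refinement {D : Type*} [MetricSpace D] [LocallyConnectedSpace D]
    {K : Set D} (hK : IsCompact K) {x y : D} {M : ℕ} {V : ℕ → Set D}
    (h : IsLinkedCover K x y M V) {ε : ℝ} (hε : 0 < ε) :
    ∃ (m : ℕ) (V' : ℕ → Set D), 0 < m ∧ IsLinkedCover K x y (M * m) V' ∧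
      (∀ j < M * m, closure (V' j) ⊆ V (j / m)) ∧
      ∀ j < M * m, ∀ a ∈ closure (V' j), ∀ b ∈ closure (V' j), dist a b ≤ ε := by
  let 𝓑 : ℕ → Set (Set D) := fun i => {B | IsOpen B ∧ IsPreconnected B ∧ B.Nonempty ∧
    closure B ⊆ V i ∧ ∀ a ∈ closure B, ∀ b ∈ closure B, dist a b ≤ ε}
  have hB : ∀ i < M, ∀ p ∈ V i, ∃ B ∈ 𝓑 i, p ∈ B := by
    intro i hi p hp
    obtain ⟨r, hr, hrV⟩ := Metric.nhds_basis_closedBall.mem_iff.1 ((h.isOpen i hi).mem_nhds hp)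
    have hr' : 0 < min r (ε / 2) := lt_min hr (half_pos hε)
    obtain ⟨B, ⟨hB1, hB2, hB3⟩, hB4⟩ :=
      (LocallyConnectedSpace.open_connected_basis p).mem_iff.1 (Metric.ball_mem_nhds p hr')
    have hcl : closure B ⊆ Metric.closedBall p (min r (ε / 2)) :=
      closure_minimal (hB4.trans Metric.ball_subset_closedBall) Metric.isClosed_closedBall
    refine ⟨B, ⟨hB1, hB3.isPreconnected, ⟨p, hB2⟩, ?_, ?_⟩, hB2⟩
    · exact hcl.trans ((Metric.closedBall_subset_closedBall (min_le_left _ _)).trans hrV)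
    · intro a ha b hb
      have h1 : dist a p ≤ ε / 2 := (hcl ha).trans (min_le_right _ _)
      have h2 : dist b p ≤ ε / 2 := (hcl hb).trans (min_le_right _ _)
      linarith [dist_triangle_right a b p]
  choose! ι hι hιV using h.cover
  choose! W hWB hW using fun k (hk : k ∈ K) => hB (ι k) (hι k hk) k (hιV k hk)
  obtain ⟨t, htK, ht⟩ := hK.elim_nhds_subcover W
    fun k hk => (hWB k hk).1.mem_nhds (hW k hk)
  have : Nonempty D := ⟨x⟩
  choose! q hq using h.inter
  let p : ℕ → D := fun i => if i = 0 then x else if i < M then q (i - 1) else y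
  have hp0 : p 0 = x := by simp [p]
  have hpM : p M = y := by simp [p, h.pos.ne']
  have hp1 : ∀ i < M, p i ∈ V i := by
    intro i hi
    rcases Nat.eq_zero_or_pos i with rfl | hi0
    · rw [hp0]; exact h.left_mem
    · simp only [p, hi0.ne', hi, if_true, if_false]
      have := (hq (i - 1) (by omega)).2
      rwa [Nat.sub_add_cancel hi0] at this
  have hp2 : ∀ i < M, p (i + 1) ∈ V i := by
    intro i hi
    rcases (Nat.succ_le_of_lt hi).eq_or_lt with hi' | hi'
    · rw [show i + 1 = M from hi', hpM, show i = M - 1 by omega]; exact h.right_mem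
    · have hi'' : i + 1 < M := hi'
      simp only [p, hi'', if_true, if_false, Nat.succ_ne_zero]
      exact (hq i hi'').1
  have hlink : ∀ i < M, LinkedThrough (𝓑 i) (W '' {k | k ∈ t ∧ ι k = i}) (p i) (p (i + 1)) := by
    intro i hi
    refine IsPreconnected.linkedThrough (h.isPreconnected i hi) (fun B hB => hB.1) (hB i hi)
      ((t.finite_toSet.subset fun k hk => hk.1).image _) ?_ ?_ (hp1 i hi) (hp2 i hi)
    · rintro _ ⟨k, ⟨hkt, rfl⟩, rfl⟩
      exact hWB k (htK k hkt)
    · rintro _ ⟨k, ⟨hkt, rfl⟩, rfl⟩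
      exact ⟨k, hW k (htK k hkt), hιV k (htK k hkt)⟩
  choose! Z hZ1 hZ2 hZ3 hZ4 hZ5 using hlink
  -- The linking sequences are infinite and stay around their targets, so one cut-off `m` serves all
  -- `i` at once.
  have hev : ∀ᶠ m : ℕ in atTop, ∀ i ∈ Finset.range M, p (i + 1) ∈ Z i (m - 1) ∧
      ∀ B ∈ W '' {k | k ∈ t ∧ ι k = i}, ∃ j < m, Z i j = B := by
    rw [eventually_all_finset]
    intro i hi
    have hi := Finset.mem_range.1 hi
    exact ((tendsto_sub_atTop_nat 1).eventually (hZ4 i hi)).and (hZ5 i hi)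
  obtain ⟨m, hm, hm0⟩ := (hev.and (eventually_gt_atTop 0)).exists
  have hdiv : ∀ j < M * m, j / m < M := fun j hj => (Nat.div_lt_iff_lt_mul hm0).2 hj
  have hgood : ∀ j < M * m, Z (j / m) (j % m) ∈ 𝓑 (j / m) := fun j hj => hZ1 _ (hdiv j hj) _
  refine ⟨m, fun j => Z (j / m) (j % m), hm0, ⟨Nat.mul_pos h.pos hm0, fun j hj => (hgood j hj).1,
    fun j hj => (hgood j hj).2.1, fun j hj => (hgood j hj).2.2.1, ?_, ?_, ?_, ?_⟩,
    fun j hj => (hgood j hj).2.2.2.1, fun j hj => (hgood j hj).2.2.2.2⟩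
  · intro j hj
    have hj' := hdiv j (by omega)
    have hjm := Nat.mod_lt j hm0
    have hdm := Nat.div_add_mod j m
    rcases (Nat.succ_le_of_lt hjm).eq_or_lt with he | hlt
    · have e1 : j + 1 = m * (j / m + 1) := by rw [mul_add]; omega
      have e2 : (j + 1) / m = j / m + 1 := by rw [e1, Nat.mul_div_cancel_left _ hm0]
      have e3 : (j + 1) % m = 0 := by rw [e1, Nat.mul_mod_right]
      simp only [e2, e3]
      have h4 : j / m + 1 < M := e2 ▸ hdiv (j + 1) hj
      refine ⟨p (j / m + 1), ?_, hZ3 _ h4⟩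
      have := (hm _ (Finset.mem_range.2 hj')).1
      rwa [show j % m = m - 1 by omega]
    · have e2 : (j + 1) / m = j / m := by
        rw [Nat.div_eq_iff hm0]
        have : j / m * m = m * (j / m) := mul_comm _ _
        omega
      have e3 : (j + 1) % m = j % m + 1 := by
        have := Nat.div_add_mod (j + 1) m
        rw [e2] at this; omega
      simp only [e2, e3]
      exact hZ2 _ hj' _
  · have := hZ3 0 h.pos
    simpa [hp0] using this
  · have e : M * m - 1 = m * (M - 1) + (m - 1) := by
      obtain ⟨M', rfl⟩ := Nat.exists_eq_succ_of_ne_zero h.pos.ne'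
      simp only [Nat.succ_sub_one, Nat.succ_mul, mul_comm m M']
      omega
    have e1 : (M * m - 1) / m = M - 1 := by
      rw [e, Nat.mul_add_div hm0, Nat.div_eq_of_lt (by omega)]; rfl
    have e2 : (M * m - 1) % m = m - 1 := by
      rw [e, Nat.mul_add_mod, Nat.mod_eq_of_lt (by omega)]
    have := (hm (M - 1) (Finset.mem_range.2 (by have := h.pos; omega))).1
    simp only [e1, e2]
    rwa [Nat.sub_add_cancel h.pos, hpM] at this
  · intro k hk
    obtain ⟨k', hk't, hk'⟩ := mem_iUnion₂.1 (ht hk)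
    have hi := hι k' (htK k' hk't)
    obtain ⟨j, hj, hjW⟩ := (hm _ (Finset.mem_range.2 hi)).2 (W k') ⟨k', ⟨hk't, rfl⟩, rfl⟩
    refine ⟨m * ι k' + j, ?_, ?_⟩
    · calc m * ι k' + j < m * ι k' + m := by omega
        _ = (ι k' + 1) * m := by ring
        _ ≤ M * m := Nat.mul_le_mul_right _ hi
    · simp only [Nat.mul_add_div hm0, Nat.div_eq_of_lt hj, Nat.mul_add_mod, Nat.mod_eq_of_lt hj,
        add_zero, hjW]
      exact hk'

lemma exists_nested_linkedCovers {D : Type*} [MetricSpace D]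
    [LocallyConnectedSpace D] {U K : Set D} (hU : IsOpen U) (hUc : IsPreconnected U)
    (hK : IsCompact K) (hKU : K ⊆ U) {x y : D} (hx : x ∈ U) (hy : y ∈ U) :
    ∃ (M mul : ℕ → ℕ) (V : ℕ → ℕ → Set D), (∀ i, V 0 i = U) ∧
      (∀ n, IsLinkedCover K x y (M n) (V n)) ∧ (∀ n, 0 < mul n) ∧
      (∀ n, M (n + 1) = M n * mul n) ∧
      (∀ n, ∀ j < M (n + 1), closure (V (n + 1) j) ⊆ V n (j / mul n)) ∧
      ∀ n, ∀ j < M (n + 1), ∀ a ∈ closure (V (n + 1) j), ∀ b ∈ closure (V (n + 1) j),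
        dist a b ≤ (1 / 2) ^ n := by
  let S := {s : ℕ × (ℕ → Set D) // IsLinkedCover K x y s.1 s.2}
  have href : ∀ (s : S) (n : ℕ), ∃ (s' : S) (m : ℕ), 0 < m ∧ s'.1.1 = s.1.1 * m ∧
      (∀ j < s'.1.1, closure (s'.1.2 j) ⊆ s.1.2 (j / m)) ∧
      ∀ j < s'.1.1, ∀ a ∈ closure (s'.1.2 j), ∀ b ∈ closure (s'.1.2 j),
        dist a b ≤ (1 / 2) ^ n := by
    intro s n
    obtain ⟨m, V', h1, h2, h3, h4⟩ := s.2.exists_refinement hK (ε := (1 / 2) ^ n) (by positivity)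
    exact ⟨⟨(s.1.1 * m, V'), h2⟩, m, h1, rfl, h3, h4⟩
  choose nxt mul hmul hnxt hcl hdist using href
  let s0 : S := ⟨(1, fun _ => U), ⟨one_pos, fun _ _ => hU, fun _ _ => hUc, fun _ _ => ⟨x, hx⟩,
    fun _ _ => ⟨x, hx, hx⟩, hx, hy, fun k hk => ⟨0, one_pos, hKU hk⟩⟩⟩
  let s : ℕ → S := fun n => Nat.rec s0 (fun n s => nxt s n) n
  exact ⟨fun n => (s n).1.1, fun n => mul (s n) n, fun n => (s n).1.2, fun _ => rfl,
    fun n => (s n).2, fun n => hmul _ _, fun n => hnxt _ _, fun n => hcl _ _, fun n => hdist _ _⟩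

/-- In a complete locally connected metric space, any two points of a connected open set are joined
by a path inside this set that covers a given compact subset. -/
theorem exists_path_covering {D : Type*} [MetricSpace D] [CompleteSpace D]
    [LocallyConnectedSpace D] {U K : Set D} (hU : IsOpen U) (hUc : IsPreconnected U)
    (hK : IsCompact K) (hKU : K ⊆ U) {x y : D} (hx : x ∈ U) (hy : y ∈ U) :
    ∃ f : ℝ → D, Continuous f ∧ f 0 = x ∧ f 1 = y ∧ (∀ t, f t ∈ U) ∧ K ⊆ f '' Icc 0 1 := by
  obtain ⟨M, mul, V, hV0, hs, hmul, hMsucc, hcl, hd⟩ :=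
    exists_nested_linkedCovers hU hUc hK hKU hx hy
  -- The link for time `t` when `[0, 1]` is cut into `M n` equal intervals. Times below `0` and from
  -- `1` on go to the first and last link, so the path is defined on all of `ℝ`.
  let idx : ℕ → ℝ → ℕ := fun n t => min ⌊t * M n⌋₊ (M n - 1)
  have hidx : ∀ n t, idx n t < M n := fun n t =>
    (min_le_right _ _).trans_lt (Nat.sub_lt (hs n).pos one_pos)
  have hidx' : ∀ n t, idx (n + 1) t / mul n = idx n t := by
    intro n t
    have hm := hmul n
    have hM := (hs n).pos
    have e1 : ⌊t * M (n + 1)⌋₊ / mul n = ⌊t * M n⌋₊ := by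
      rw [← Nat.floor_div_natCast, hMsucc]
      congr 1
      push_cast
      have : (mul n : ℝ) ≠ 0 := by positivity
      field_simp
    have e2 : (M (n + 1) - 1) / mul n = M n - 1 := by
      rw [hMsucc, Nat.div_eq_iff hm]
      obtain ⟨M', hM'⟩ := Nat.exists_eq_succ_of_ne_zero hM.ne'
      rw [hM']
      simp only [Nat.succ_sub_one, Nat.succ_mul]
      omega
    have hmono : Monotone fun j : ℕ => j / mul n := fun a b hab => Nat.div_le_div_right hab
    change min _ _ / _ = min _ _
    rw [hmono.map_min, e1, e2]
  have hsub : ∀ n t, closure (V (n + 1) (idx (n + 1) t)) ⊆ V n (idx n t) := by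
    intro n t
    have := hcl n (idx (n + 1) t) (hidx (n + 1) t)
    rwa [hidx'] at this
  have hex : ∀ t, ∃ z, ∀ n, z ∈ V n (idx n t) := by
    intro t
    have hanti : Antitone fun n => closure (V (n + 1) (idx (n + 1) t)) :=
      antitone_nat_of_succ_le fun n => (hsub (n + 1) t).trans subset_closure
    have hne : (⋂ n, closure (V (n + 1) (idx (n + 1) t))).Nonempty := by
      apply Metric.nonempty_iInter_of_nonempty_biInter (fun _ => isClosed_closure)
      · intro n
        rw [Metric.isBounded_iff]
        exact ⟨_, fun a ha b hb => hd n _ (hidx _ _) a ha b hb⟩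
      · intro N
        refine ((hs (N + 1)).nonempty _ (hidx (N + 1) t)).mono ?_
        exact subset_iInter₂ fun n hn => subset_closure.trans (hanti hn)
      · refine squeeze_zero (fun _ => Metric.diam_nonneg) (fun n => ?_)
          (tendsto_pow_atTop_nhds_zero_of_lt_one (r := (1 / 2 : ℝ)) (by norm_num) (by norm_num))
        exact Metric.diam_le_of_forall_dist_le (by positivity) fun a ha b hb =>
          hd n _ (hidx _ _) a ha b hb
    obtain ⟨z, hz⟩ := hne
    exact ⟨z, fun n => hsub n t (mem_iInter.1 hz n)⟩
  choose f hf using hex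
  have hd' : ∀ n, ∀ j < M (n + 1), ∀ a ∈ V (n + 1) j, ∀ b ∈ V (n + 1) j,
      dist a b ≤ (1 / 2) ^ n := fun n j hj a ha b hb =>
    hd n j hj a (subset_closure ha) b (subset_closure hb)
  have heq : ∀ a b : D, (∀ n : ℕ, dist a b ≤ (1 / 2) ^ n) → a = b := by
    intro a b hab
    refine dist_le_zero.1 (ge_of_tendsto' (tendsto_pow_atTop_nhds_zero_of_lt_one
      (r := (1 / 2 : ℝ)) (by norm_num) (by norm_num)) hab)
  have hcont : Continuous f := by
    rw [Metric.continuous_iff']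
    intro t ε hε
    obtain ⟨n, hn⟩ := exists_pow_lt_of_lt_one (half_pos hε) (show (1 / 2 : ℝ) < 1 by norm_num)
    have hM : (0 : ℝ) < M (n + 1) := by exact_mod_cast (hs (n + 1)).pos
    -- Times closer than `1 / M (n + 1)` have equal or adjacent indices, hence meeting links.
    filter_upwards [Metric.ball_mem_nhds t (one_div_pos.2 hM)] with u hu
    rw [Metric.mem_ball, Real.dist_eq, abs_lt] at hu
    have hu1 : u * M (n + 1) < t * M (n + 1) + 1 := by
      have : (u - t) * M (n + 1) < 1 := by rw [← lt_div_iff₀ hM]; exact hu.2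
      linarith
    have hu2 : t * M (n + 1) < u * M (n + 1) + 1 := by
      have : (t - u) * M (n + 1) < 1 := by rw [← lt_div_iff₀ hM]; linarith [hu.1]
      linarith
    have key : ∀ a b : ℝ, a < b + 1 → ⌊a⌋₊ ≤ ⌊b⌋₊ + 1 := by
      intro a b hab
      rcases le_or_gt 0 b with hb | hb
      · rw [← Nat.floor_add_one hb]; exact Nat.floor_le_floor hab.le
      · exact (Nat.floor_le_floor (show a ≤ 1 by linarith)).trans (by simp)
    have k1 := key _ _ hu1
    have k2 := key _ _ hu2
    have hmeet : (V (n + 1) (idx (n + 1) u) ∩ V (n + 1) (idx (n + 1) t)).Nonempty := by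
      have hu3 := hidx (n + 1) u
      have ht3 := hidx (n + 1) t
      have h5 : idx (n + 1) u = idx (n + 1) t ∨ idx (n + 1) u = idx (n + 1) t + 1 ∨
          idx (n + 1) t = idx (n + 1) u + 1 := by
        simp only [idx]; omega
      rcases h5 with h5 | h5 | h5
      · rw [h5, inter_self]; exact (hs _).nonempty _ ht3
      · rw [h5, inter_comm]; exact (hs _).inter _ (h5 ▸ hu3)
      · rw [h5]; exact (hs _).inter _ (h5 ▸ ht3)
    obtain ⟨z, hz1, hz2⟩ := hmeet
    have := hd' n _ (hidx _ _) _ (hf u (n + 1)) _ hz1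
    have := hd' n _ (hidx _ _) _ hz2 _ (hf t (n + 1))
    linarith [dist_triangle (f u) z (f t)]
  refine ⟨f, hcont, ?_, ?_, fun t => hV0 _ ▸ hf t 0, ?_⟩
  · refine heq _ _ fun n => hd' n 0 (hs _).pos _ ?_ _ (hs _).left_mem
    simpa [idx] using hf 0 (n + 1)
  · refine heq _ _ fun n => hd' n (M (n + 1) - 1) (Nat.sub_lt (hs _).pos one_pos) _ ?_ _
      (hs _).right_mem
    simpa [idx] using hf 1 (n + 1)
  · intro k hk
    have hcl : IsClosed (f '' Icc 0 1) := (isCompact_Icc.image hcont).isClosed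
    rw [← hcl.closure_eq, Metric.mem_closure_iff]
    intro ε hε
    obtain ⟨n, hn⟩ := exists_pow_lt_of_lt_one hε (show (1 / 2 : ℝ) < 1 by norm_num)
    obtain ⟨i, hi, hki⟩ := (hs (n + 1)).cover k hk
    have hM : (0 : ℝ) < M (n + 1) := by exact_mod_cast (hs (n + 1)).pos
    have hi' : (i : ℝ) ≤ M (n + 1) := by exact_mod_cast hi.le
    refine ⟨_, ⟨(i : ℝ) / M (n + 1), ⟨by positivity, (div_le_one hM).2 hi'⟩, rfl⟩, ?_⟩
    refine (hd' n i hi _ hki _ ?_).trans_lt hn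
    have e : idx (n + 1) ((i : ℝ) / M (n + 1)) = i := by
      simp only [idx]
      rw [div_mul_cancel₀ _ hM.ne', Nat.floor_natCast]
      omega
    have := hf ((i : ℝ) / M (n + 1)) (n + 1)
    rwa [e] at this


/-! ### Arcs inside paths -/

/-- A path whose fibres are intervals is a reparametrized arc. -/
lemma exists_arc_of_ordConnected_fibers {D : Type*} [MetricSpace D]
    [TopologicalSpace.SeparableSpace D] {δ : ℝ → D} (hδ : ContinuousOn δ (Icc 0 1))
    (hconv : ∀ s ∈ Icc (0 : ℝ) 1, ∀ t ∈ Icc (0 : ℝ) 1, δ s = δ t → ∀ u ∈ Icc s t, δ u = δ s)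
    (hne : δ 0 ≠ δ 1) :
    ∃ α : ℝ → D, Continuous α ∧ InjOn α (Icc 0 1) ∧ α 0 = δ 0 ∧ α 1 = δ 1 ∧
      α '' Icc 0 1 ⊆ δ '' Icc 0 1 := by
  have : Nonempty D := ⟨δ 0⟩
  have h0 : (0 : ℝ) ∈ Icc (0 : ℝ) 1 := by simp
  have h1 : (1 : ℝ) ∈ Icc (0 : ℝ) 1 := by simp
  let y : ℕ → D := TopologicalSpace.denseSeq D
  let E : ℝ → Set D := fun t => δ '' Icc 0 t
  have hEne : ∀ t ∈ Icc (0 : ℝ) 1, (E t).Nonempty := fun t ht => ⟨_, 0, ⟨le_rfl, ht.1⟩, rfl⟩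
  have hEc : ∀ t ∈ Icc (0 : ℝ) 1, IsCompact (E t) := fun t ht =>
    isCompact_Icc.image_of_continuousOn (hδ.mono (Icc_subset_Icc_right ht.2))
  have hEmono : ∀ {s t : ℝ}, s ≤ t → E s ⊆ E t := fun hst =>
    image_mono (Icc_subset_Icc_right hst)
  -- The weighted sum `g` of the distances from a dense sequence to the initial piece `E t` drops
  -- exactly when `E t` grows. After normalization it is a parameter `k` with the same fibres as
  -- `δ`, and `δ` descends along the quotient map `k`.
  let h : ℕ → ℝ → ℝ := fun n t => (1 / 2) ^ n * min 1 (Metric.infDist (y n) (E t))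
  have hh0 : ∀ n t, 0 ≤ h n t := fun n t =>
    mul_nonneg (by positivity) (le_min zero_le_one Metric.infDist_nonneg)
  have hh1 : ∀ n t, h n t ≤ (1 / 2) ^ n := fun n t =>
    mul_le_of_le_one_right (by positivity) (min_le_left _ _)
  have hsum : Summable fun n : ℕ => (1 / 2 : ℝ) ^ n := summable_geometric_two
  have hhs : ∀ t, Summable fun n => h n t := fun t =>
    Summable.of_nonneg_of_le (fun n => hh0 n t) (fun n => hh1 n t) hsum
  have hanti : ∀ n, ∀ s ∈ Icc (0 : ℝ) 1, ∀ t, s ≤ t → h n t ≤ h n s := fun n s hs t hst =>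
    mul_le_mul_of_nonneg_left
      (min_le_min le_rfl (Metric.infDist_le_infDist_of_subset (hEmono hst) (hEne s hs)))
      (by positivity)
  have hcont : ∀ n, ContinuousOn (h n) (Icc 0 1) := by
    intro n
    refine continuousOn_const.mul (ContinuousOn.inf continuousOn_const ?_)
    have huc := isCompact_Icc.uniformContinuousOn_of_continuous hδ
    rw [Metric.uniformContinuousOn_iff] at huc
    rw [Metric.continuousOn_iff]
    intro t ht ε hε
    obtain ⟨η, hη, hη'⟩ := huc (ε / 2) (half_pos hε)
    refine ⟨η, hη, ?_⟩
    have key : ∀ a ∈ Icc (0 : ℝ) 1, ∀ b ∈ Icc (0 : ℝ) 1, a ≤ b → dist a b < η →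
        dist (Metric.infDist (y n) (E a)) (Metric.infDist (y n) (E b)) < ε := by
      intro a ha b hb hab hd
      have e1 := Metric.infDist_le_infDist_of_subset (x := y n) (hEmono hab) (hEne a ha)
      obtain ⟨_, ⟨s, hs, rfl⟩, hs'⟩ := (hEc b hb).exists_infDist_eq_dist (hEne b hb) (y n)
      have hs1 : s ∈ Icc (0 : ℝ) 1 := ⟨hs.1, hs.2.trans hb.2⟩
      have hm : min s a ∈ Icc (0 : ℝ) 1 := ⟨le_min hs.1 ha.1, (min_le_right _ _).trans ha.2⟩
      have e2 : Metric.infDist (y n) (E a) ≤ dist (y n) (δ (min s a)) :=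
        Metric.infDist_le_dist_of_mem ⟨_, ⟨hm.1, min_le_right _ _⟩, rfl⟩
      have e3 : dist (δ s) (δ (min s a)) < ε / 2 := by
        refine hη' s hs1 _ hm (lt_of_le_of_lt ?_ hd)
        rw [Real.dist_eq, Real.dist_eq, abs_of_nonneg (sub_nonneg.2 (min_le_left _ _)),
          abs_sub_comm, abs_of_nonneg (sub_nonneg.2 hab)]
        rcases le_total s a with h | h
        · rw [min_eq_left h]; linarith
        · rw [min_eq_right h]; linarith [hs.2]
      rw [Real.dist_eq, abs_of_nonneg (sub_nonneg.2 e1), hs']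
      linarith [dist_triangle (y n) (δ s) (δ (min s a))]
    intro s hs hst
    rcases le_total s t with h | h
    · exact key s hs t ht h hst
    · rw [dist_comm]; exact key t ht s hs h (by rwa [dist_comm])
  let g : ℝ → ℝ := fun t => ∑' n, h n t
  have hg : ContinuousOn g (Icc 0 1) := continuousOn_tsum hcont hsum fun n t _ => by
    rw [Real.norm_of_nonneg (hh0 n t)]; exact hh1 n t
  have hgconst : ∀ s ∈ Icc (0 : ℝ) 1, ∀ t ∈ Icc (0 : ℝ) 1, s ≤ t → δ s = δ t → g s = g t := by
    intro s hs t ht hst he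
    have : E s = E t := by
      refine (hEmono hst).antisymm ?_
      rintro _ ⟨u, hu, rfl⟩
      rcases le_total u s with h | h
      · exact ⟨u, ⟨hu.1, h⟩, rfl⟩
      · exact ⟨s, ⟨hs.1, le_rfl⟩, (hconv s hs t ht he u ⟨h, hu.2⟩).symm⟩
    simp only [g, h, this]
  have hglt : ∀ s ∈ Icc (0 : ℝ) 1, ∀ t ∈ Icc (0 : ℝ) 1, s ≤ t → δ s ≠ δ t → g t < g s := by
    intro s hs t ht hst he
    have hnot : δ t ∉ E s := by
      rintro ⟨u, hu, hu'⟩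
      exact he ((hconv u ⟨hu.1, hu.2.trans hs.2⟩ t ht hu' s ⟨hu.2, hst⟩).trans hu')
    have hr : 0 < Metric.infDist (δ t) (E s) :=
      ((hEc s hs).isClosed.notMem_iff_infDist_pos (hEne s hs)).1 hnot
    set r := Metric.infDist (δ t) (E s)
    have hr' : 0 < min 1 r / 3 := by positivity
    obtain ⟨n, hn⟩ : ∃ n, dist (δ t) (y n) < min 1 r / 3 :=
      (TopologicalSpace.denseRange_denseSeq D).exists_dist_lt (δ t) hr'
    refine Summable.tsum_lt_tsum (i := n) (fun i => hanti i s hs t hst) ?_ (hhs t) (hhs s)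
    refine mul_lt_mul_of_pos_left ?_ (by positivity)
    have e1 : Metric.infDist (y n) (E t) ≤ dist (y n) (δ t) :=
      Metric.infDist_le_dist_of_mem ⟨t, ⟨ht.1, le_rfl⟩, rfl⟩
    have e2 : r ≤ Metric.infDist (y n) (E s) + dist (δ t) (y n) :=
      Metric.infDist_le_infDist_add_dist
    rw [dist_comm] at e1
    have := min_le_left 1 r
    have := min_le_right 1 r
    exact (min_le_right _ _).trans_lt (lt_min (by linarith) (by linarith))
  have hgiff : ∀ s ∈ Icc (0 : ℝ) 1, ∀ t ∈ Icc (0 : ℝ) 1, g s = g t → δ s = δ t := by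
    intro s hs t ht he
    by_contra hn
    rcases le_total s t with h | h
    · exact (hglt s hs t ht h hn).ne' he
    · exact (hglt t ht s hs h (Ne.symm hn)).ne he
  have hg01 : 0 < g 0 - g 1 := sub_pos.2 (hglt 0 h0 1 h1 zero_le_one hne)
  have hgle : ∀ s ∈ Icc (0 : ℝ) 1, ∀ t ∈ Icc (0 : ℝ) 1, s ≤ t → g t ≤ g s :=
    fun s hs t ht hst => (hhs t).tsum_le_tsum (fun i => hanti i s hs t hst) (hhs s)
  let k : ℝ → ℝ := fun t => (g 0 - g t) / (g 0 - g 1)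
  have hk0 : k 0 = 0 := by simp [k]
  have hk1 : k 1 = 1 := div_self hg01.ne'
  have hkc : ContinuousOn k (Icc 0 1) := (continuousOn_const.sub hg).div_const _
  have hkm : ∀ t ∈ Icc (0 : ℝ) 1, k t ∈ Icc (0 : ℝ) 1 := fun t ht =>
    ⟨div_nonneg (sub_nonneg.2 (hgle 0 h0 t ht ht.1)) hg01.le,
      (div_le_one hg01).2 (by linarith [hgle t ht 1 h1 ht.2])⟩
  have hkδ : ∀ s ∈ Icc (0 : ℝ) 1, ∀ t ∈ Icc (0 : ℝ) 1, k s = k t → δ s = δ t := by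
    intro s hs t ht he
    have := (div_left_inj' hg01.ne').1 he
    exact hgiff s hs t ht (by linarith)
  have hδk : ∀ s ∈ Icc (0 : ℝ) 1, ∀ t ∈ Icc (0 : ℝ) 1, δ s = δ t → k s = k t := by
    intro s hs t ht he
    have : g s = g t := by
      rcases le_total s t with h | h
      · exact hgconst s hs t ht h he
      · exact (hgconst t ht s hs h he.symm).symm
    simp only [k, this]
  have hsurj : ∀ v ∈ Icc (0 : ℝ) 1, ∃ t ∈ Icc (0 : ℝ) 1, k t = v := by
    intro v hv
    have := intermediate_value_Icc zero_le_one hkc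
    rw [hk0, hk1] at this
    exact this hv
  let k' : Icc (0 : ℝ) 1 → Icc (0 : ℝ) 1 := fun t => ⟨k t, hkm t t.2⟩
  have hk'c : Continuous k' := (continuousOn_iff_continuous_domRestrict.1 hkc).subtype_mk _
  have hk's : Function.Surjective k' := fun v => by
    obtain ⟨t, ht, htv⟩ := hsurj v v.2
    exact ⟨⟨t, ht⟩, Subtype.ext htv⟩
  have hq : IsQuotientMap k' := .of_surjective_continuous hk's hk'c
  let α' : Icc (0 : ℝ) 1 → D := fun v => δ (hk's v).choose
  have hα' : ∀ t : Icc (0 : ℝ) 1, α' (k' t) = δ t := fun t =>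
    hkδ _ (Subtype.prop _) _ t.2 (congrArg Subtype.val (hk's (k' t)).choose_spec)
  have hα'c : Continuous α' := by
    rw [hq.continuous_iff]
    exact (continuousOn_iff_continuous_domRestrict.1 hδ).congr fun t => (hα' t).symm
  have hext : ∀ t (ht : t ∈ Icc (0 : ℝ) 1), IccExtend zero_le_one α' t = α' ⟨t, ht⟩ :=
    fun t ht => IccExtend_of_mem _ _ ht
  refine ⟨IccExtend zero_le_one α', hα'c.Icc_extend', ?_, ?_, ?_, ?_⟩
  · intro s hs t ht hst
    rw [hext s hs, hext t ht] at hst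
    have := hδk _ (Subtype.prop _) _ (Subtype.prop _) hst
    have e1 := congrArg Subtype.val (hk's ⟨s, hs⟩).choose_spec
    have e2 := congrArg Subtype.val (hk's ⟨t, ht⟩).choose_spec
    exact (e1.symm.trans this).trans e2
  · rw [hext 0 h0, ← hα' ⟨0, h0⟩]
    congr 1; exact Subtype.ext hk0.symm
  · rw [hext 1 h1, ← hα' ⟨1, h1⟩]
    congr 1; exact Subtype.ext hk1.symm
  · rintro _ ⟨t, ht, rfl⟩
    rw [hext t ht]
    exact ⟨_, Subtype.prop _, rfl⟩

/-- The closed subsets of `[0, 1]` containing both ends such that `f` agrees at the two ends of each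
of their gaps. -/
def GapSets {D : Type*} (f : ℝ → D) : Set (Set ℝ) :=
  {C | IsClosed C ∧ C ⊆ Icc 0 1 ∧ 0 ∈ C ∧ 1 ∈ C ∧
    ∀ a ∈ C, ∀ b ∈ C, a < b → (∀ c ∈ Ioo a b, c ∉ C) → f a = f b}

/-- Zorn's lemma. If `(a, b)` is a gap of the intersection of a chain, compactness gives a member
missing `[a + η, b - η]`. That member has a gap with ends `η`-close to `a` and `b`, where `f`
agrees; now let `η` shrink. -/
lemma exists_minimal_gapSet {D : Type*} [MetricSpace D] {f : ℝ → D} (hf : Continuous f) :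
    ∃ C, Minimal (· ∈ GapSets f) C := by
  refine zorn_superset _ fun 𝒞 h𝒞 hchain => ?_
  rcases 𝒞.eq_empty_or_nonempty with rfl | hne
  · refine ⟨Icc 0 1, ⟨isClosed_Icc, Subset.rfl, by simp, by simp, ?_⟩, by simp⟩
    intro a ha b hb hab hgap
    exact absurd (⟨by linarith [ha.1], by linarith [hb.2]⟩ : (a + b) / 2 ∈ Icc (0 : ℝ) 1)
      (hgap _ ⟨by linarith, by linarith⟩)
  refine ⟨⋂₀ 𝒞, ⟨isClosed_sInter fun C hC => (h𝒞 hC).1, ?_, fun C hC => (h𝒞 hC).2.2.1,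
    fun C hC => (h𝒞 hC).2.2.2.1, ?_⟩, fun C hC => sInter_subset_of_mem hC⟩
  · obtain ⟨C, hC⟩ := hne
    exact (sInter_subset_of_mem hC).trans (h𝒞 hC).2.1
  intro a ha b hb hab hgap
  refine eq_of_forall_dist_le fun ε hε => ?_
  obtain ⟨η₁, hη₁, h1⟩ := Metric.continuous_iff.1 hf a (ε / 2) (half_pos hε)
  obtain ⟨η₂, hη₂, h2⟩ := Metric.continuous_iff.1 hf b (ε / 2) (half_pos hε)
  obtain ⟨η, hη0, hη⟩ : ∃ η > 0, η < min (min η₁ η₂) ((b - a) / 2) :=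
    exists_between (lt_min (lt_min hη₁ hη₂) (by linarith))
  have e1 : η < η₁ := hη.trans_le ((min_le_left _ _).trans (min_le_left _ _))
  have e2 : η < η₂ := hη.trans_le ((min_le_left _ _).trans (min_le_right _ _))
  have e3 : η < (b - a) / 2 := hη.trans_le (min_le_right _ _)
  have : Nonempty 𝒞 := hne.to_subtype
  obtain ⟨⟨C, hC⟩, hCK⟩ := (isCompact_Icc : IsCompact (Icc (a + η) (b - η))).elim_directed_family_closed
    (fun C : 𝒞 => C.1) (fun C => (h𝒞 C.2).1) (by
      rw [← sInter_eq_iInter, eq_empty_iff_forall_notMem]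
      rintro c ⟨hc, hc'⟩
      exact hgap c ⟨by linarith [hc.1], by linarith [hc.2]⟩ hc')
    (by
      intro C C'
      rcases hchain.total C.2 C'.2 with h | h
      · exact ⟨C, Subset.rfl, h⟩
      · exact ⟨C', h, Subset.rfl⟩)
  have hCK' : ∀ c ∈ C, ¬ (a + η ≤ c ∧ c ≤ b - η) := fun c hc hc' =>
    (eq_empty_iff_forall_notMem.1 hCK) c ⟨hc', hc⟩
  have hCcl := (h𝒞 hC).1
  obtain ⟨a', ⟨ha'C, ha'⟩, ha'max⟩ :=
    (isCompact_Icc.inter_left hCcl : IsCompact (C ∩ Icc a (a + η))).exists_isGreatest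
      ⟨a, ha C hC, le_rfl, by linarith⟩
  obtain ⟨b', ⟨hb'C, hb'⟩, hb'min⟩ :=
    (isCompact_Icc.inter_left hCcl : IsCompact (C ∩ Icc (b - η) b)).exists_isLeast
      ⟨b, hb C hC, by linarith, le_rfl⟩
  have heq : f a' = f b' := by
    refine (h𝒞 hC).2.2.2.2 a' ha'C b' hb'C (by linarith [ha'.2, hb'.1]) fun c hc hcC => ?_
    by_cases h3 : c ≤ a + η
    · exact (ha'max ⟨hcC, ha'.1.trans hc.1.le, h3⟩).not_gt hc.1
    by_cases h4 : b - η ≤ c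
    · exact (hb'min ⟨hcC, h4, hc.2.le.trans hb'.2⟩).not_gt hc.2
    exact hCK' c hcC ⟨by linarith, by linarith⟩
  have d1 := h1 a' (by rw [Real.dist_eq, abs_of_nonneg] <;> linarith [ha'.1, ha'.2])
  have d2 := h2 b' (by rw [Real.dist_eq, abs_of_nonpos] <;> linarith [hb'.1, hb'.2])
  rw [heq] at d1
  linarith [dist_triangle_left (f a) (f b) (f b')]

/-- A path with distinct end points contains an arc with the same end points. -/
theorem exists_arc_of_path {D : Type*} [MetricSpace D] [TopologicalSpace.SeparableSpace D] {f : ℝ → D}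
    (hf : Continuous f) (hne : f 0 ≠ f 1) :
    ∃ α : ℝ → D, Continuous α ∧ InjOn α (Icc 0 1) ∧ α 0 = f 0 ∧ α 1 = f 1 ∧
      α '' Icc 0 1 ⊆ f '' Icc 0 1 := by
  obtain ⟨C, ⟨hC, hmin⟩⟩ := exists_minimal_gapSet hf
  obtain ⟨hCcl, hCI, hC0, hC1, hCgap⟩ := id hC
  -- If `f s = f t`, cutting `(s, t)` out of `C` leaves a gap set, so by minimality nothing was cut
  -- out.
  have hinj : ∀ s ∈ C, ∀ t ∈ C, s < t → f s = f t → ∀ c ∈ Ioo s t, c ∉ C := by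
    intro s hs t ht hst he c hc hcC
    have hmem : C \ Ioo s t ∈ GapSets f := by
      refine ⟨hCcl.sdiff isOpen_Ioo, sdiff_subset.trans hCI, ⟨hC0, fun h => ?_⟩,
        ⟨hC1, fun h => ?_⟩, ?_⟩
      · exact (hCI hs).1.not_gt h.1
      · exact (hCI ht).2.not_gt h.2
      · intro a ha b hb hab hgap
        by_cases h : ∃ d ∈ Ioo a b, d ∈ C
        · obtain ⟨d, hd, hdC⟩ := h
          have hdst : d ∈ Ioo s t := by
            by_contra hn
            exact hgap d hd ⟨hdC, hn⟩
          have h1 : a ≤ s := by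
            by_contra hn
            exact ha.2 ⟨not_le.1 hn, hd.1.trans hdst.2⟩
          have h2 : s ≤ a := by
            by_contra hn
            exact hgap s ⟨not_le.1 hn, hdst.1.trans hd.2⟩ ⟨hs, fun h => h.1.false⟩
          have h3 : t ≤ b := by
            by_contra hn
            exact hb.2 ⟨hdst.1.trans hd.2, not_le.1 hn⟩
          have h4 : b ≤ t := by
            by_contra hn
            exact hgap t ⟨hd.1.trans hdst.2, not_le.1 hn⟩ ⟨ht, fun h => h.2.false⟩
          rw [h1.antisymm h2, h4.antisymm h3]
          exact he
        · push Not at h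
          exact hCgap a ha.1 b hb.1 hab h
    exact (hmin hmem sdiff_subset hcC).2 hc
  -- Rounding `t` down to `C` makes `f ∘ ρ` constant on each gap. It is continuous because `f`
  -- agrees at the ends of gaps, and its fibres are intervals by `hinj`.
  have hρ : ∀ t ∈ Icc (0 : ℝ) 1, ∃ c, IsGreatest (C ∩ Icc 0 t) c := fun t ht =>
    (isCompact_Icc.inter_left hCcl : IsCompact (C ∩ Icc 0 t)).exists_isGreatest
      ⟨0, hC0, le_rfl, ht.1⟩
  choose! ρ hρ using hρ
  have hρC : ∀ t ∈ Icc (0 : ℝ) 1, ρ t ∈ C := fun t ht => (hρ t ht).1.1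
  have hρle : ∀ t ∈ Icc (0 : ℝ) 1, ρ t ≤ t := fun t ht => (hρ t ht).1.2.2
  have hρmax : ∀ t ∈ Icc (0 : ℝ) 1, ∀ c ∈ C, c ≤ t → c ≤ ρ t := fun t ht c hc hct =>
    (hρ t ht).2 ⟨hc, (hCI hc).1, hct⟩
  have hρid : ∀ t ∈ C, ρ t = t := fun t ht =>
    (hρle t (hCI ht)).antisymm (hρmax t (hCI ht) t ht le_rfl)
  have hρmono : ∀ s ∈ Icc (0 : ℝ) 1, ∀ t ∈ Icc (0 : ℝ) 1, s ≤ t → ρ s ≤ ρ t :=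
    fun s hs t ht hst => hρmax t ht _ (hρC s hs) ((hρle s hs).trans hst)
  have hcont : ContinuousOn (f ∘ ρ) (Icc 0 1) := by
    rw [Metric.continuousOn_iff]
    have huc := isCompact_Icc.uniformContinuousOn_of_continuous (hf.continuousOn (s := Icc 0 1))
    rw [Metric.uniformContinuousOn_iff] at huc
    intro t ht ε hε
    obtain ⟨η, hη, hη'⟩ := huc ε hε
    have key : ∀ a ∈ Icc (0 : ℝ) 1, ∀ b ∈ Icc (0 : ℝ) 1, a ≤ b → dist a b < η →
        dist (f (ρ a)) (f (ρ b)) < ε := by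
      intro a ha b hb hab hd
      by_cases h : ∃ c ∈ C, c ∈ Icc a b
      · obtain ⟨c₀, hc₀, hc₀'⟩ := h
        obtain ⟨c, ⟨hcC, hc⟩, hcmin⟩ :=
          (isCompact_Icc.inter_left hCcl : IsCompact (C ∩ Icc a b)).exists_isLeast
            ⟨c₀, hc₀, hc₀'⟩
        have e1 : f (ρ a) = f c := by
          rcases ((hρle a ha).trans hc.1).eq_or_lt with h | h
          · rw [h]
          · refine hCgap _ (hρC a ha) c hcC h fun d hd hdC => ?_
            rcases le_or_gt d a with h' | h'
            · exact (hρmax a ha d hdC h').not_gt hd.1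
            · exact (hcmin ⟨hdC, h'.le, hd.2.le.trans hc.2⟩).not_gt hd.2
        rw [e1]
        refine hη' c (hCI hcC) _ (hCI (hρC b hb)) (lt_of_le_of_lt ?_ hd)
        have := hρmax b hb c hcC hc.2
        have := hρle b hb
        rw [dist_comm c, dist_comm a, Real.dist_eq, Real.dist_eq, abs_of_nonneg (by linarith),
          abs_of_nonneg (by linarith)]
        linarith [hc.1]
      · push Not at h
        have : ρ a = ρ b := by
          refine (hρmono a ha b hb hab).antisymm (hρmax a ha _ (hρC b hb) ?_)
          by_contra hn
          exact h _ (hρC b hb) ⟨(not_le.1 hn).le, hρle b hb⟩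
        rw [this, dist_self]; exact hε
    refine ⟨η, hη, fun s hs hst => ?_⟩
    rcases le_total s t with h | h
    · exact key s hs t ht h hst
    · rw [dist_comm]; exact key t ht s hs h (by rwa [dist_comm])
  have e0 : (f ∘ ρ) 0 = f 0 := by simp [hρid 0 hC0]
  have e1 : (f ∘ ρ) 1 = f 1 := by simp [hρid 1 hC1]
  obtain ⟨α, h1, h2, h3, h4, h5⟩ := exists_arc_of_ordConnected_fibers hcont (by
    intro s hs t ht he u hu
    have hu1 : u ∈ Icc (0 : ℝ) 1 := ⟨hs.1.trans hu.1, hu.2.trans ht.2⟩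
    have l1 := hρmono s hs u hu1 hu.1
    have l2 := hρmono u hu1 t ht hu.2
    rcases l1.eq_or_lt with h | h
    · simp only [Function.comp, h]
    rcases l2.eq_or_lt with h' | h'
    · simp only [Function.comp] at he ⊢; rw [h', he]
    exact absurd (hρC u hu1)
      (hinj _ (hρC s hs) _ (hρC t ht) (h.trans h') he _ ⟨h, h'⟩)) (by rwa [e0, e1])
  refine ⟨α, h1, h2, h3.trans e0, h4.trans e1, h5.trans ?_⟩
  rintro _ ⟨t, ht, rfl⟩
  exact ⟨ρ t, hCI (hρC t ht), rfl⟩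


/-! ### Simple closed curves from two arcs -/

lemma hasSimpleClosedCurve_of_loop {D : Type*} [TopologicalSpace D] {σ : ℝ → D}
    (hσ : Continuous σ) (hinj : InjOn σ (Ico 0 2)) (hloop : σ 0 = σ 2) :
    HasSimpleClosedCurve D := by
  have : Fact ((0 : ℝ) < 2) := ⟨two_pos⟩
  let e := AddCircle.homeomorphCircle (T := (2 : ℝ)) two_ne_zero
  have hrep : ∀ x : AddCircle (2 : ℝ), ∃ t ∈ Ico (0 : ℝ) 2, (t : AddCircle (2 : ℝ)) = x := by
    intro x
    have : x ∈ ((↑) : ℝ → AddCircle (2 : ℝ)) '' Ico 0 (0 + 2) := by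
      rw [AddCircle.coe_image_Ico_eq]; trivial
    rwa [zero_add] at this
  refine ⟨AddCircle.liftIco 2 0 σ ∘ e.symm,
    (AddCircle.liftIco_zero_continuous hloop hσ.continuousOn).comp e.symm.continuous,
    Function.Injective.comp ?_ e.symm.injective⟩
  intro x y hxy
  obtain ⟨s, hs, rfl⟩ := hrep x
  obtain ⟨t, ht, rfl⟩ := hrep y
  rw [AddCircle.liftIco_zero_coe_apply hs, AddCircle.liftIco_zero_coe_apply ht] at hxy
  rw [hinj hs ht hxy]

/-- Two arcs with the same end points, one of which misses an interior point of the other, contain a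
simple closed curve in their union. -/
lemma hasSimpleClosedCurve_of_two_arcs {D : Type*} [TopologicalSpace D] [T2Space D] {α β : ℝ → D}
    (hα : Continuous α) (hαi : InjOn α (Icc 0 1)) (hβ : Continuous β) (hβi : InjOn β (Icc 0 1))
    (h0 : β 0 = α 0) (h1 : β 1 = α 1) {t : ℝ} (ht : t ∈ Ioo (0 : ℝ) 1)
    (hmiss : α t ∉ β '' Icc 0 1) : HasSimpleClosedCurve D := by
  have hB : IsClosed (α ⁻¹' (β '' Icc 0 1)) := (isCompact_Icc.image hβ).isClosed.preimage hα
  obtain ⟨s₁, ⟨⟨u, hu, hu'⟩, hs₁⟩, hmax⟩ :=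
    (isCompact_Icc.inter_left hB : IsCompact (α ⁻¹' (β '' Icc 0 1) ∩ Icc 0 t)).exists_isGreatest
      ⟨0, ⟨0, by simp, h0⟩, le_rfl, ht.1.le⟩
  obtain ⟨s₂, ⟨⟨v, hv, hv'⟩, hs₂⟩, hmin⟩ :=
    (isCompact_Icc.inter_left hB : IsCompact (α ⁻¹' (β '' Icc 0 1) ∩ Icc t 1)).exists_isLeast
      ⟨1, ⟨1, by simp, h1⟩, ht.2.le, le_rfl⟩
  have hs₁t : s₁ < t := lt_of_le_of_ne hs₁.2 fun h => hmiss (h ▸ ⟨u, hu, hu'⟩)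
  have hs₂t : t < s₂ := lt_of_le_of_ne hs₂.1 fun h => hmiss (h ▸ ⟨v, hv, hv'⟩)
  have hfree : ∀ s ∈ Ioo s₁ s₂, α s ∉ β '' Icc 0 1 := by
    intro s hs hsB
    rcases le_total s t with h | h
    · exact (hmax ⟨hsB, hs₁.1.trans hs.1.le, h⟩).not_gt hs.1
    · exact (hmin ⟨hsB, h, hs.2.le.trans hs₂.2⟩).not_gt hs.2
  have huv : u ≠ v := by
    rintro rfl
    have := hαi ⟨hs₁.1, hs₁.2.trans ht.2.le⟩ ⟨ht.1.le.trans hs₂.1, hs₂.2⟩ (hu'.symm.trans hv')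
    linarith
  -- The loop follows `α` from `s₁` to `s₂`, the excursion around `t` that avoids `β`, and returns
  -- along `β` from `v` to `u`.
  let a : ℝ → ℝ := fun x => s₁ + x * (s₂ - s₁)
  let b : ℝ → ℝ := fun x => v + (x - 1) * (u - v)
  have ha : ∀ x ∈ Icc (0 : ℝ) 1, a x ∈ Icc s₁ s₂ := fun x hx =>
    ⟨by simp only [a]; nlinarith [hx.1], by simp only [a]; nlinarith [hx.2]⟩
  have haI : ∀ x ∈ Icc (0 : ℝ) 1, a x ∈ Icc (0 : ℝ) 1 := fun x hx =>
    ⟨hs₁.1.trans (ha x hx).1, (ha x hx).2.trans hs₂.2⟩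
  have hb : ∀ x ∈ Icc (1 : ℝ) 2, b x ∈ Icc (0 : ℝ) 1 := by
    intro x hx
    have : b x = (2 - x) * v + (x - 1) * u := by simp only [b]; ring
    rw [this]
    have h1 : 0 ≤ 2 - x := by linarith [hx.2]
    have h2 : 0 ≤ x - 1 := by linarith [hx.1]
    refine ⟨add_nonneg (mul_nonneg h1 hv.1) (mul_nonneg h2 hu.1), ?_⟩
    nlinarith [mul_le_mul_of_nonneg_left hv.2 h1, mul_le_mul_of_nonneg_left hu.2 h2]
  have hainj : ∀ x y, a x = a y → x = y := fun x y h => by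
    have : s₂ - s₁ ≠ 0 := by linarith
    exact mul_right_cancel₀ this (add_left_cancel h)
  have hbinj : ∀ x y, b x = b y → x = y := fun x y h => by
    have := mul_right_cancel₀ (sub_ne_zero.2 huv) (add_left_cancel h)
    linarith
  have hcross : ∀ x ∈ Ico (0 : ℝ) 2, ∀ y ∈ Ico (0 : ℝ) 2, x ≤ 1 → 1 < y → α (a x) ≠ β (b y) := by
    intro x hx y hy hx1 hy1 he
    have hax := ha x ⟨hx.1, hx1⟩
    have hby := hb y ⟨hy1.le, hy.2.le⟩
    rcases hax.1.eq_or_lt with h | h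
    · rw [← h, ← hu'] at he
      have := hβi hu hby he
      have h2 : b 2 = u := by simp only [b]; ring
      have := hbinj 2 y (h2.trans this)
      linarith [hy.2]
    rcases hax.2.eq_or_lt with h' | h'
    · rw [h', ← hv'] at he
      have := hβi hv hby he
      have h2 : b 1 = v := by simp [b]
      have := hbinj 1 y (h2.trans this)
      linarith
    · exact hfree _ ⟨h, h'⟩ (he ▸ ⟨_, hby, rfl⟩)
  refine hasSimpleClosedCurve_of_loop (σ := fun x => if x ≤ 1 then α (a x) else β (b x)) ?_ ?_ ?_
  · refine Continuous.if_le (hα.comp (by fun_prop)) (hβ.comp (by fun_prop)) continuous_id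
      continuous_const fun x hx => ?_
    simp [a, b, show x = 1 from hx, hv']
  · intro x hx y hy hxy
    by_cases hx1 : x ≤ 1 <;> by_cases hy1 : y ≤ 1 <;> simp only [hx1, hy1, if_true, if_false] at hxy
    · exact hainj _ _ (hαi (haI x ⟨hx.1, hx1⟩) (haI y ⟨hy.1, hy1⟩) hxy)
    · exact absurd hxy (hcross x hx y hy hx1 (not_le.1 hy1))
    · exact absurd hxy.symm (hcross y hy x hx hy1 (not_le.1 hx1))
    · exact hbinj _ _ (hβi (hb x ⟨(not_le.1 hx1).le, hx.2.le⟩) (hb y ⟨(not_le.1 hy1).le, hy.2.le⟩)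
        hxy)
  · norm_num [a, b, hu']

/-! ### The first-point retraction of a dendrite onto an arc -/

/-- The data of an arc in a dendrite together with the first-point retraction onto it, read in the
parameter of the arc. -/
structure IsArcRetraction {D : Type*} [TopologicalSpace D] (α : ℝ → D) (φ : D → ℝ) : Prop where
  continuous_arc : Continuous α
  continuous : Continuous φ
  mem_Icc : ∀ x, φ x ∈ Icc (0 : ℝ) 1
  apply_arc : ∀ t ∈ Icc (0 : ℝ) 1, φ (α t) = t
  fiber : ∀ x, ∃ C, IsPreconnected C ∧ x ∈ C ∧ α (φ x) ∈ C ∧ ∀ z ∈ C, φ z = φ x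

/-- Each `x` is joined inside its fibre to `α (φ x)`, and the part of the arc over `J` is connected.
-/
lemma IsArcRetraction.isPreconnected_preimage {D : Type*} [TopologicalSpace D] {α : ℝ → D}
    {φ : D → ℝ} (h : IsArcRetraction α φ) (J : Set ℝ) (hJ : J.OrdConnected) :
    IsPreconnected (φ ⁻¹' J) := by
  choose C hC hxC hαC hφC using h.fiber
  have hJ' : IsPreconnected (α '' (J ∩ Icc 0 1)) :=
    (hJ.inter ordConnected_Icc).isPreconnected.image _ h.continuous_arc.continuousOn
  rcases (J ∩ Icc 0 1).eq_empty_or_nonempty with he | ⟨t, ht⟩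
  · have : φ ⁻¹' J = ∅ := by
      rw [eq_empty_iff_forall_notMem] at he ⊢
      exact fun x hx => he (φ x) ⟨hx, h.mem_Icc x⟩
    rw [this]; exact isPreconnected_empty
  have hαJ : ∀ s ∈ J ∩ Icc 0 1, α s ∈ φ ⁻¹' J := fun s hs => by
    rw [mem_preimage, h.apply_arc s hs.2]; exact hs.1
  refine isPreconnected_of_forall (α t) fun x hx => ?_
  refine ⟨C x ∪ α '' (J ∩ Icc 0 1), union_subset (fun z hz => ?_) ?_,
    .inr ⟨t, ht, rfl⟩, .inl (hxC x),
    (hC x).union (α (φ x)) (hαC x) ⟨φ x, ⟨hx, h.mem_Icc x⟩, rfl⟩ hJ'⟩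
  · rw [mem_preimage, hφC x z hz]; exact hx
  · rintro _ ⟨s, hs, rfl⟩; exact hαJ s hs


lemma closure_connectedComponentIn_compl_singleton_subset {D : Type*} [TopologicalSpace D]
    {c x : D} (hx : x ≠ c) :
    closure (connectedComponentIn {c}ᶜ x) ⊆ insert c (connectedComponentIn {c}ᶜ x) := by
  intro z hz
  by_cases hzc : z = c
  · exact .inl hzc
  · right
    have hpre : IsPreconnected (insert z (connectedComponentIn {c}ᶜ x)) :=
      isPreconnected_connectedComponentIn.subset_closure (subset_insert _ _)
        (insert_subset hz subset_closure)
    exact hpre.subset_connectedComponentIn (mem_insert_of_mem _ (mem_connectedComponentIn hx))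
      (insert_subset hzc (connectedComponentIn_subset _ _)) (mem_insert _ _)

/-- Interior points of an arc in a dendrite separate its end points. -/
lemma IsDendrite.arc_end_notMem_connectedComponentIn {D : Type*} [MetricSpace D]
    (h : IsDendrite D) {α : ℝ → D} (hα : Continuous α) (hαi : InjOn α (Icc 0 1)) {t : ℝ}
    (ht : t ∈ Ioo (0 : ℝ) 1) : α 1 ∉ connectedComponentIn {α t}ᶜ (α 0) := by
  intro h1
  have := h.compact
  have := h.locallyConnected
  have h0t : α 0 ≠ α t := fun he => ht.1.ne (hαi (by simp) (Ioo_subset_Icc_self ht) he)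
  obtain ⟨f, hf, hf0, hf1, hfU, -⟩ := exists_path_covering
    (isOpen_compl_singleton.connectedComponentIn) isPreconnected_connectedComponentIn
    isCompact_empty (empty_subset _) (mem_connectedComponentIn h0t) h1
  have hne : f 0 ≠ f 1 := by
    rw [hf0, hf1]
    exact fun he => zero_ne_one (hαi (by simp) (by simp) he)
  obtain ⟨β, hβ, hβi, hβ0, hβ1, hβf⟩ := exists_arc_of_path hf hne
  refine h.acyclic (hasSimpleClosedCurve_of_two_arcs hα hαi hβ hβi (hβ0.trans hf0)
    (hβ1.trans hf1) ht fun hm => ?_)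
  obtain ⟨s, -, hs⟩ := hβf hm
  exact connectedComponentIn_subset _ _ (hfU s) hs

/-- Let `P t` be the side of the cut point `α t` containing `α 0`. Since `closure (P s) ⊆ P t` for
`s < t`, the infimum of the `t` with `x ∈ P t` is continuous in `x`, as in Urysohn's lemma. -/
theorem IsDendrite.exists_isArcRetraction {D : Type*} [MetricSpace D] [Nontrivial D]
    (h : IsDendrite D) : ∃ (α : ℝ → D) (φ : D → ℝ), IsArcRetraction α φ := by
  have := h.compact
  have := h.locallyConnected
  have := h.connected
  obtain ⟨p, q, hpq⟩ := exists_pair_ne D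
  obtain ⟨f, hf, hf0, hf1, -, -⟩ := exists_path_covering (D := D) isOpen_univ isPreconnected_univ
    isCompact_empty (empty_subset _) (mem_univ p) (mem_univ q)
  obtain ⟨α, hα, hαi, -, -, -⟩ := exists_arc_of_path hf (by rwa [hf0, hf1])
  let P : ℝ → Set D := fun t => connectedComponentIn {α t}ᶜ (α 0)
  have hne : ∀ s ∈ Icc (0 : ℝ) 1, ∀ t ∈ Icc (0 : ℝ) 1, s ≠ t → α s ≠ α t :=
    fun s hs t ht hst he => hst (hαi hs ht he)
  have hI0 : (0 : ℝ) ∈ Icc (0 : ℝ) 1 := by simp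
  have hP0 : ∀ t ∈ Ioo (0 : ℝ) 1, α 0 ∈ P t := fun t ht =>
    mem_connectedComponentIn (hne 0 hI0 t (Ioo_subset_Icc_self ht) ht.1.ne)
  have hPo : ∀ t, IsOpen (P t) := fun t => isOpen_compl_singleton.connectedComponentIn
  have hPlt : ∀ t ∈ Ioo (0 : ℝ) 1, ∀ s ∈ Ico 0 t, α s ∈ P t := by
    intro t ht s hs
    have hpre : IsPreconnected (α '' Icc 0 s) := isPreconnected_Icc.image _ hα.continuousOn
    refine hpre.subset_connectedComponentIn ⟨0, ⟨le_rfl, hs.1⟩, rfl⟩ ?_ ⟨s, ⟨hs.1, le_rfl⟩, rfl⟩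
    rintro _ ⟨u, hu, rfl⟩
    exact hne u ⟨hu.1, (hu.2.trans hs.2.le).trans ht.2.le⟩ t (Ioo_subset_Icc_self ht)
      (hu.2.trans_lt hs.2).ne
  have hPge : ∀ t ∈ Ioo (0 : ℝ) 1, ∀ s ∈ Icc t 1, α s ∉ P t := by
    intro t ht s hs hm
    rcases hs.1.eq_or_lt with rfl | hts
    · exact connectedComponentIn_subset _ _ hm rfl
    · have hpre : IsPreconnected (α '' Icc s 1) := isPreconnected_Icc.image _ hα.continuousOn
      refine h.arc_end_notMem_connectedComponentIn hα hαi ht ?_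
      rw [connectedComponentIn_eq hm]
      refine hpre.subset_connectedComponentIn ⟨s, ⟨le_rfl, hs.2⟩, rfl⟩ ?_ ⟨1, ⟨hs.2, le_rfl⟩, rfl⟩
      rintro _ ⟨u, hu, rfl⟩
      exact hne u ⟨ht.1.le.trans (hs.1.trans hu.1), hu.2⟩ t (Ioo_subset_Icc_self ht)
        (hts.trans_le hu.1).ne'
  have hPcl : ∀ s ∈ Ioo (0 : ℝ) 1, ∀ t ∈ Ioo (0 : ℝ) 1, s < t → closure (P s) ⊆ P t := by
    intro s hs t ht hst
    refine isPreconnected_connectedComponentIn.closure.subset_connectedComponentIn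
      (subset_closure (hP0 s hs)) fun z hz hzt => ?_
    rw [mem_singleton_iff.1 hzt] at hz
    rcases closure_connectedComponentIn_compl_singleton_subset
      (hne 0 hI0 s (Ioo_subset_Icc_self hs) hs.1.ne) hz with he | hm
    · exact hne _ (Ioo_subset_Icc_self ht) _ (Ioo_subset_Icc_self hs) hst.ne' he
    · exact hPge s hs t ⟨hst.le, ht.2.le⟩ hm
  let S : D → Set ℝ := fun x => {t | t = 1 ∨ t ∈ Ioo (0 : ℝ) 1 ∧ x ∈ P t}
  have hS1 : ∀ x, 1 ∈ S x := fun x => .inl rfl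
  have hS0 : ∀ x, ∀ t ∈ S x, 0 ≤ t := by
    rintro x t (rfl | ht)
    · exact zero_le_one
    · exact ht.1.1.le
  have hSb : ∀ x, BddBelow (S x) := fun x => ⟨0, hS0 x⟩
  let φ : D → ℝ := fun x => sInf (S x)
  have hφle : ∀ x, ∀ t ∈ S x, φ x ≤ t := fun x t ht => csInf_le (hSb x) ht
  have hφI : ∀ x, φ x ∈ Icc (0 : ℝ) 1 := fun x =>
    ⟨le_csInf ⟨1, hS1 x⟩ (hS0 x), hφle x 1 (hS1 x)⟩
  have hφP : ∀ x, ∀ t ∈ Ioo (0 : ℝ) 1, φ x < t → x ∈ P t := by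
    intro x t ht hlt
    obtain ⟨s, hs, hst⟩ := exists_lt_of_csInf_lt ⟨1, hS1 x⟩ hlt
    rcases hs with rfl | hs
    · exact absurd ht.2 hst.le.not_gt
    · exact hPcl s hs.1 t ht hst (subset_closure hs.2)
  have hPφ : ∀ x, ∀ t ∈ Ioo (0 : ℝ) 1, x ∈ P t → φ x ≤ t := fun x t ht hx =>
    hφle x t (.inr ⟨ht, hx⟩)
  have hφc : Continuous φ := by
    refine continuous_iff_continuousAt.2 fun x => tendsto_order.2 ⟨fun v hv => ?_, fun v hv => ?_⟩
    · rcases lt_or_ge v 0 with hv0 | hv0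
      · exact .of_forall fun z => hv0.trans_le (hφI z).1
      · obtain ⟨s, hvs, hs⟩ := exists_between hv
        obtain ⟨s', hss', hs'⟩ := exists_between hs
        have h1 := (hφI x).2
        have hsI : s ∈ Ioo (0 : ℝ) 1 := ⟨by linarith, by linarith⟩
        have hs'I : s' ∈ Ioo (0 : ℝ) 1 := ⟨by linarith, by linarith⟩
        have hx : x ∈ (closure (P s))ᶜ := fun hx =>
          (hPφ x s' hs'I (hPcl s hsI s' hs'I hss' hx)).not_gt hs'
        filter_upwards [isClosed_closure.isOpen_compl.mem_nhds hx] with z hz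
        refine hvs.trans_le (not_lt.1 fun hlt => hz (subset_closure (hφP z s hsI hlt)))
    · rcases lt_or_ge 1 v with hv1 | hv1
      · exact .of_forall fun z => (hφI z).2.trans_lt hv1
      · obtain ⟨s, hxs, hs⟩ := exists_between hv
        have hsI : s ∈ Ioo (0 : ℝ) 1 := ⟨(hφI x).1.trans_lt hxs, hs.trans_le hv1⟩
        filter_upwards [(hPo s).mem_nhds (hφP x s hsI hxs)] with z hz
        exact (hPφ z s hsI hz).trans_lt hs
  have hφα : ∀ t ∈ Icc (0 : ℝ) 1, φ (α t) = t := by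
    intro t ht
    refine le_antisymm (not_lt.1 fun hlt => ?_) (not_lt.1 fun hlt => ?_)
    · obtain ⟨s, hts, hs⟩ := exists_between hlt
      have hsI : s ∈ Ioo (0 : ℝ) 1 := ⟨ht.1.trans_lt hts, hs.trans_le (hφI _).2⟩
      exact (hPφ _ s hsI (hPlt s hsI t ⟨ht.1, hts⟩)).not_gt hs
    · obtain ⟨s, hts, hs⟩ := exists_between hlt
      have hsI : s ∈ Ioo (0 : ℝ) 1 := ⟨(hφI _).1.trans_lt hts, hs.trans_le ht.2⟩
      exact hPge s hsI t ⟨hs.le, ht.2⟩ (hφP _ s hsI hts)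
  refine ⟨α, φ, hα, hφc, hφI, hφα, fun x => ?_⟩
  by_cases hx : x ∈ α '' Icc 0 1
  · obtain ⟨t, ht, rfl⟩ := hx
    refine ⟨{α t}, isPreconnected_singleton, rfl, ?_, fun z hz => by rw [hz]⟩
    rw [hφα t ht]; rfl
  -- `W` avoids every `α t`, so it cannot straddle a cut and `φ` is constant on it. Its closure
  -- reaches the arc, as otherwise `W` would be clopen, and it does so at `α (φ x)`.
  let W := connectedComponentIn (α '' Icc 0 1)ᶜ x
  have hAcl : IsClosed (α '' Icc 0 1) := (isCompact_Icc.image hα).isClosed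
  have hWo : IsOpen W := hAcl.isOpen_compl.connectedComponentIn
  have hxW : x ∈ W := mem_connectedComponentIn hx
  have hWpre : IsPreconnected W := isPreconnected_connectedComponentIn
  have hle : ∀ z ∈ W, ∀ w ∈ W, φ w ≤ φ z := by
    intro z hz w hw
    refine not_lt.1 fun hlt => ?_
    obtain ⟨t, hzt, htw⟩ := exists_between hlt
    have htI : t ∈ Ioo (0 : ℝ) 1 := ⟨(hφI z).1.trans_lt hzt, htw.trans_le (hφI w).2⟩
    have hWt : W ⊆ {α t}ᶜ := fun u hu hut =>
      connectedComponentIn_subset _ _ hu ⟨t, Ioo_subset_Icc_self htI, hut.symm⟩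
    have hzP := hφP z t htI hzt
    have : W ⊆ P t := by
      simp only [P]
      rw [connectedComponentIn_eq hzP]
      exact hWpre.subset_connectedComponentIn hz hWt
    exact (hPφ w t htI (this hw)).not_gt htw
  have hWcl : ∀ z ∈ closure W, φ z = φ x :=
    closure_minimal (fun z hz => (hle x hxW z hz).antisymm (hle z hz x hxW))
      (isClosed_singleton.preimage hφc)
  have hmeet : (closure W ∩ α '' Icc 0 1).Nonempty := by
    by_contra hn
    rw [not_nonempty_iff_eq_empty, eq_empty_iff_forall_notMem] at hn
    have hsub : closure W ⊆ W := hWpre.closure.subset_connectedComponentIn (subset_closure hxW)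
      fun z hz hz' => hn z ⟨hz, hz'⟩
    have hclop : IsClopen W := ⟨isClosed_of_closure_subset hsub, hWo⟩
    have huniv := hclop.eq_univ ⟨x, hxW⟩
    exact connectedComponentIn_subset _ _ (huniv ▸ mem_univ (α 0) : α 0 ∈ W) ⟨0, hI0, rfl⟩
  obtain ⟨_, hw, t, ht, rfl⟩ := hmeet
  refine ⟨closure W, hWpre.closure, subset_closure hxW, ?_, hWcl⟩
  rwa [← hWcl _ hw, hφα t ht]

/-! ### Sweeping out the dendrite along the arc -/

/-- The whole space is covered by a path that stays close to a given arc as far as the retraction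
onto the arc can see. -/
theorem IsArcRetraction.exists_filling {D : Type*} [MetricSpace D] [CompactSpace D]
    [LocallyConnectedSpace D] {α : ℝ → D} {φ : D → ℝ} (h : IsArcRetraction α φ) {δ : ℝ}
    (hδ : 0 < δ) : ∃ f : ℝ → D, Continuous f ∧ (∀ t ∈ Icc (0 : ℝ) 1, |φ (f t) - t| ≤ δ) ∧
      f '' Icc 0 1 = univ := by
  obtain ⟨n, hn⟩ := exists_nat_gt (2 / δ)
  have hn0 : (0 : ℝ) < n := (by positivity : 0 < 2 / δ).trans hn
  have hnδ : 2 / n < δ := by rwa [div_lt_iff₀ hn0, mul_comm, ← div_lt_iff₀ hδ]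
  have key : ∀ k : ℕ, k ≤ n → ∃ f : ℝ → D, Continuous f ∧ f (k / n) = α (k / n) ∧
      (∀ t ∈ Icc (0 : ℝ) (k / n), |φ (f t) - t| ≤ 2 / n) ∧
      ∀ j < k, φ ⁻¹' Icc (j / n) ((j + 1) / n) ⊆ f '' Icc 0 (k / n) := by
    intro k
    induction k with
    | zero =>
      intro _
      refine ⟨fun _ => α 0, continuous_const, by simp, fun t ht => ?_, by simp⟩
      have : t = 0 := by simpa using ht
      rw [h.apply_arc 0 (by simp), this]
      simp only [sub_zero, abs_zero]
      positivity
    | succ k ih =>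
      intro hk
      obtain ⟨f, hf, hfk, hfφ, hfc⟩ := ih (by omega)
      have hkn : (k : ℝ) + 1 ≤ n := by exact_mod_cast hk
      have hk0 : (0 : ℝ) ≤ k := k.cast_nonneg
      have hkI : (k / n : ℝ) ∈ Icc (0 : ℝ) 1 := ⟨by positivity, by rw [div_le_one hn0]; linarith⟩
      have hkI' : ((k + 1) / n : ℝ) ∈ Icc (0 : ℝ) 1 := ⟨by positivity, by rwa [div_le_one hn0]⟩
      have e : ((k : ℝ) + 1) / n = k / n + 1 / n := add_div _ _ _
      have h1n : (0 : ℝ) < 1 / n := by positivity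
      have e2 : (2 : ℝ) / n = 1 / n + 1 / n := by ring
      -- The strip over `[k / n, (k + 1) / n]` is filled inside the strip widened by `1 / n` on both
      -- sides, which is open and connected; this costs an error of at most `2 / n`.
      obtain ⟨g, hg, hg0, hg1, hgU, hgK⟩ := exists_path_covering
        (isOpen_Ioo.preimage h.continuous :
          IsOpen (φ ⁻¹' Ioo ((k : ℝ) / n - 1 / n) ((k + 1) / n + 1 / n)))
        (h.isPreconnected_preimage _ ordConnected_Ioo)
        (isClosed_Icc.preimage h.continuous).isCompact
        (preimage_mono (Icc_subset_Ioo (by linarith) (by linarith)) :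
          φ ⁻¹' Icc (k / n) ((k + 1) / n) ⊆ _)
        (x := α (k / n)) (y := α ((k + 1) / n))
        (by rw [mem_preimage, h.apply_arc _ hkI]; constructor <;> linarith)
        (by rw [mem_preimage, h.apply_arc _ hkI']; constructor <;> linarith)
      push_cast
      have hlt : (k / n : ℝ) < (k + 1) / n := by linarith
      have hpar : n * (((k : ℝ) + 1) / n) - k = 1 := by field_simp; ring
      refine ⟨fun t => if t ≤ k / n then f t else g (n * t - k), ?_, ?_, ?_, ?_⟩
      · refine Continuous.if_le hf (hg.comp (by fun_prop)) continuous_id continuous_const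
          fun t ht => ?_
        have : n * t - k = 0 := by rw [show t = k / n from ht]; field_simp; ring
        rw [this, hg0, show t = k / n from ht, hfk]
      · simp only [hlt.not_ge, if_false, hpar, hg1]
      · intro t ht
        by_cases h' : t ≤ k / n
        · simpa only [h', if_true] using hfφ t ⟨ht.1, h'⟩
        · simp only [h', if_false]
          have h3 := hgU (n * t - k)
          rw [abs_le]
          constructor <;> linarith [h3.1, h3.2, not_le.1 h', ht.2]
      · intro j hj x hx
        rcases (Nat.lt_succ_iff.1 hj).eq_or_lt with rfl | hj'
        · obtain ⟨s, hs, hsx⟩ := hgK hx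
          have hs' : (n : ℝ) * ((j + s) / n) - j = s := by field_simp; ring
          rcases hs.1.eq_or_lt with rfl | hs0
          · refine ⟨j / n, ⟨hkI.1, hlt.le⟩, ?_⟩
            simp only [le_rfl, if_true]
            rw [hfk, ← hg0, hsx]
          · refine ⟨(j + s) / n, ⟨div_nonneg (by linarith) hn0.le, ?_⟩, ?_⟩
            · exact div_le_div_of_nonneg_right (by linarith [hs.2]) hn0.le
            · have : ¬ ((j : ℝ) + s) / n ≤ j / n := by
                rw [not_le]; exact div_lt_div_of_pos_right (by linarith) hn0
              simp only [this, if_false, hs', hsx]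
        · obtain ⟨t, ht, htx⟩ := hfc j hj' hx
          exact ⟨t, ⟨ht.1, ht.2.trans hlt.le⟩, by simpa only [ht.2, if_true] using htx⟩
  obtain ⟨f, hf, -, hfφ, hfc⟩ := key n le_rfl
  rw [div_self hn0.ne'] at hfφ hfc
  refine ⟨f, hf, fun t ht => (hfφ t ht).trans hnδ.le, eq_univ_of_forall fun x => ?_⟩
  have hx := h.mem_Icc x
  have hnN : 0 < n := by exact_mod_cast hn0
  rcases hx.2.eq_or_lt with hx1 | hx1
  · refine hfc (n - 1) (by omega) ?_
    have : ((n - 1 : ℕ) : ℝ) + 1 = n := by exact_mod_cast Nat.sub_add_cancel hnN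
    rw [mem_preimage, hx1, this, div_self hn0.ne']
    exact ⟨by rw [div_le_one hn0]; linarith, le_rfl⟩
  · refine hfc ⌊φ x * n⌋₊ ((Nat.floor_lt (by have := hx.1; positivity)).2 (by nlinarith)) ?_
    constructor
    · rw [div_le_iff₀ hn0]; exact Nat.floor_le (by have := hx.1; positivity)
    · rw [le_div_iff₀ hn0]; exact (Nat.lt_floor_add_one _).le


/-! ### Maps of chainable continua onto the interval -/

/-- Quantitative injectivity of an `ε`-mapping of a compact space. -/
lemma exists_pos_forall_le_dist {X P : Type*} [MetricSpace X] [CompactSpace X] [MetricSpace P]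
    {g : X → P} (hg : Continuous g) {ε : ℝ} (h : ∀ x y, g x = g y → dist x y < ε) :
    ∃ η > 0, ∀ x y, ε ≤ dist x y → η ≤ dist (g x) (g y) := by
  have hK : IsCompact {p : X × X | ε ≤ dist p.1 p.2} :=
    (isClosed_le continuous_const continuous_dist).isCompact
  obtain ⟨η, hη, h'⟩ := hK.exists_forall_le' (f := fun p => dist (g p.1) (g p.2)) (a := 0)
    (by fun_prop) fun p hp => dist_pos.2 fun he => (h _ _ he).not_ge hp
  exact ⟨η, hη, fun x y hxy => h' (x, y) hxy⟩

/-- Average the link indices by a subordinate partition of unity. Only adjacent links meet, so `g x`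
is within `1` of the index of any link with positive weight at `x`. Equal values therefore put two
points into equal or adjacent links, each smaller than `ε / 2`. -/
lemma IsChainable.exists_real_epsMapping {X : Type*} [MetricSpace X] [CompactSpace X]
    (hX : IsChainable X) {ε : ℝ} (hε : 0 < ε) :
    ∃ g : X → ℝ, Continuous g ∧ ∀ x y, g x = g y → dist x y < ε := by
  obtain ⟨n, L, hL, hLo, hLd, hLu⟩ := hX (ε / 2) (half_pos hε)
  obtain ⟨w, hw⟩ := PartitionOfUnity.exists_isSubordinate isClosed_univ L hLo hLu.ge
  have hwL : ∀ i x, w i x ≠ 0 → x ∈ L i := fun i x hx => hw i (subset_tsupport _ hx)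
  have hsum : ∀ x, ∑ i, w i x = 1 := fun x => by
    rw [← finsum_eq_sum_of_fintype]; exact w.sum_eq_one (mem_univ x)
  let g : X → ℝ := fun x => ∑ i : Fin n, ((i : ℕ) : ℝ) * w i x
  have hex : ∀ x, ∃ i, w i x ≠ 0 := by
    intro x
    by_contra! hn
    simpa [hn] using hsum x
  have hclose : ∀ x i, w i x ≠ 0 → |g x - (i : ℕ)| < 1 := by
    intro x i hi
    have e1 : g x - (i : ℕ) = ∑ j : Fin n, (((j : ℕ) : ℝ) - (i : ℕ)) * w j x := by
      simp only [sub_mul, Finset.sum_sub_distrib, ← Finset.mul_sum, hsum, mul_one, g]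
    rw [e1]
    refine (Finset.abs_sum_le_sum_abs _ _).trans_lt ?_
    rw [← hsum x]
    refine Finset.sum_lt_sum (fun j _ => ?_) ⟨i, Finset.mem_univ _, ?_⟩
    · rw [abs_mul, abs_of_nonneg (w.nonneg j x)]
      by_cases hj : w j x = 0
      · simp [hj]
      · refine mul_le_of_le_one_left (w.nonneg j x) ?_
        obtain ⟨h1, h2⟩ := (hL i j).1 ⟨x, hwL i x hi, hwL j x hj⟩
        have h1' : ((i : ℕ) : ℝ) ≤ (j : ℕ) + 1 := by exact_mod_cast h1
        have h2' : ((j : ℕ) : ℝ) ≤ (i : ℕ) + 1 := by exact_mod_cast h2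
        rw [abs_le]; constructor <;> linarith
    · simpa using (w.nonneg i x).lt_of_ne' hi
  have hdist : ∀ i, ∀ x ∈ L i, ∀ y ∈ L i, dist x y < ε / 2 := fun i x hx y hy =>
    (Metric.dist_le_diam_of_mem (isCompact_univ.isBounded.subset (subset_univ _)) hx hy).trans_lt
      (hLd i)
  refine ⟨g, ?_, fun x y hxy => ?_⟩
  · exact continuous_finsetSum _ fun i _ => continuous_const.mul (w i).continuous
  · obtain ⟨i, hi⟩ := hex x
    obtain ⟨j, hj⟩ := hex y
    have h1 := abs_lt.1 (hclose x i hi)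
    have h2 := abs_lt.1 (hclose y j hj)
    have h3 : ((i : ℕ) : ℝ) < (j : ℕ) + 2 := by linarith
    have h4 : ((j : ℕ) : ℝ) < (i : ℕ) + 2 := by linarith
    have h3' : (i : ℕ) < j + 2 := by exact_mod_cast h3
    have h4' : (j : ℕ) < i + 2 := by exact_mod_cast h4
    obtain ⟨z, hzi, hzj⟩ := (hL i j).2 ⟨by omega, by omega⟩
    linarith [dist_triangle x z y, hdist i x (hwL i x hi) z hzi, hdist j z hzj y (hwL j y hj)]

theorem IsChainable.exists_epsMapping_unitInterval {X : Type*} [MetricSpace X] [CompactSpace X]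
    [ConnectedSpace X] [Nontrivial X] (hX : IsChainable X) {ε : ℝ} (hε : 0 < ε) :
    ∃ g : C(X, unitInterval), Function.Surjective g ∧ ∀ x y, g x = g y → dist x y < ε := by
  obtain ⟨p, q, hpq⟩ := exists_pair_ne X
  -- Fibres smaller than `dist p q` keep `g` from being constant, so its range can be rescaled to
  -- `[0, 1]`.
  obtain ⟨g, hg, hgε⟩ := hX.exists_real_epsMapping (lt_min hε (dist_pos.2 hpq))
  obtain ⟨a, -, ha⟩ := isCompact_univ.exists_isMinOn univ_nonempty hg.continuousOn
  obtain ⟨b, -, hb⟩ := isCompact_univ.exists_isMaxOn univ_nonempty hg.continuousOn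
  have ha : ∀ x, g a ≤ g x := fun x => ha (mem_univ x)
  have hb : ∀ x, g x ≤ g b := fun x => hb (mem_univ x)
  have hab : 0 < g b - g a := by
    rw [sub_pos]
    refine lt_of_not_ge fun h => ?_
    have hc : ∀ x, g x = g a := fun x => ((hb x).trans h).antisymm (ha x)
    exact ((hgε p q ((hc p).trans (hc q).symm)).trans_le (min_le_right _ _)).false
  refine ⟨⟨fun x => ⟨(g x - g a) / (g b - g a), div_nonneg (sub_nonneg.2 (ha x)) hab.le,
    (div_le_one hab).2 (sub_le_sub_right (hb x) _)⟩, by fun_prop⟩, fun t => ?_, fun x y hxy => ?_⟩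
  · obtain ⟨x, hx⟩ := mem_range_of_exists_le_of_exists_ge (c := g a + t * (g b - g a)) hg
      ⟨a, by nlinarith [t.2.1]⟩ ⟨b, by nlinarith [t.2.2]⟩
    refine ⟨x, Subtype.ext ?_⟩
    change (g x - g a) / (g b - g a) = t
    rw [hx, add_sub_cancel_left, mul_div_cancel_right₀ _ hab.ne']
  · have := (div_left_inj' hab.ne').1 (congrArg Subtype.val hxy)
    exact (hgε x y (by linarith)).trans_le (min_le_left _ _)

/-- A map onto the interval factors approximately through every `ε`-mapping onto the interval. -/
theorem exists_approx_factorization {X : Type*} [MetricSpace X] [CompactSpace X]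
    (g : C(X, unitInterval)) (hg : Function.Surjective g) {δ : ℝ} (hδ : 0 < δ) :
    ∃ ε > 0, ∀ g' : C(X, unitInterval), Function.Surjective g' →
      (∀ x y, g' x = g' y → dist x y < ε) →
      ∃ h : C(unitInterval, unitInterval), Function.Surjective h ∧
        ∀ x, dist (h (g' x)) (g x) ≤ δ := by
  obtain ⟨d, hd0, hdδ, hd4⟩ : ∃ d > 0, 4 * d ≤ δ ∧ d ≤ 1 / 4 :=
    ⟨min (δ / 4) (1 / 4), by positivity, by linarith [min_le_left (δ / 4) (1 / 4)],
      min_le_right _ _⟩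
  obtain ⟨ε, hε, hgε⟩ := Metric.uniformContinuous_iff.1
    (CompactSpace.uniformContinuous_of_continuous g.continuous) d hd0
  refine ⟨ε, hε, fun g' hg' hg'ε => ?_⟩
  -- On a fibre of `g'` the map `g` varies by less than `d`, so a value of `g` there is an
  -- admissible value of `h`; it stays admissible nearby, and the admissible sets are convex.
  obtain ⟨h, hh⟩ := exists_continuous_forall_mem_convex_of_local_const
    (X := unitInterval) (t := fun u => {v : ℝ | ∀ x, g' x = u → v ∈ Metric.ball (g x : ℝ) d}) (by
      intro u
      simp only [ofPred_forall]
      exact convex_iInter fun x => convex_iInter fun _ => convex_ball _ _) (by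
      intro u
      obtain ⟨x₀, rfl⟩ := hg' u
      have hK : IsCompact {x | d ≤ dist (g x₀) (g x)} :=
        (isClosed_le continuous_const (by fun_prop)).isCompact
      have hcl : IsClosed (g' '' {x | d ≤ dist (g x₀) (g x)}) :=
        (hK.image g'.continuous).isClosed
      refine ⟨g x₀, ?_⟩
      have hmem : g' x₀ ∈ (g' '' {x | d ≤ dist (g x₀) (g x)})ᶜ := by
        rintro ⟨x, hx, he⟩
        exact (hgε (hg'ε x₀ x he.symm)).not_ge hx
      filter_upwards [hcl.isOpen_compl.mem_nhds hmem] with u hu x hx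
      by_contra hn
      refine hu ⟨x, ?_, hx⟩
      rw [Metric.mem_ball] at hn
      exact not_lt.1 hn)
  have hh' : ∀ x, |h (g' x) - g x| < d := fun x => hh (g' x) x rfl
  have h12 : 0 < 1 - 2 * d := by linarith
  -- `h` is only known to come within `d` of `0` and `1`. Stretching `[d, 1 - d]` onto `[0, 1]` and
  -- clamping makes it onto, at an extra cost of `3 * d`.
  let s : ℝ → unitInterval := fun v => projIcc 0 1 zero_le_one ((v - d) / (1 - 2 * d))
  have hs : Continuous s := continuous_projIcc.comp (by fun_prop)
  refine ⟨⟨fun u => s (h u), by fun_prop⟩, fun t => ?_, fun x => ?_⟩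
  · obtain ⟨x₀, hx₀⟩ := hg 0
    obtain ⟨x₁, hx₁⟩ := hg 1
    have b0 := abs_lt.1 (hh' x₀)
    have b1 := abs_lt.1 (hh' x₁)
    rw [hx₀] at b0
    rw [hx₁] at b1
    simp only [Icc.coe_zero, Icc.coe_one] at b0 b1
    have e0 : s (h (g' x₀)) = 0 := projIcc_of_le_left _
      (div_nonpos_of_nonpos_of_nonneg (by linarith) h12.le)
    have e1 : s (h (g' x₁)) = 1 := projIcc_of_right_le _
      ((one_le_div h12).2 (by linarith))
    exact mem_range_of_exists_le_of_exists_ge (f := fun u => s (h u)) (hs.comp h.continuous)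
      ⟨g' x₀, by rw [e0]; exact t.2.1⟩ ⟨g' x₁, by rw [e1]; exact t.2.2⟩
  · have b := abs_lt.1 (hh' x)
    set v := h (g' x)
    have hgx := (g x).2
    have e1 : projIcc (0 : ℝ) 1 zero_le_one (g x : ℝ) = g x := projIcc_val _ _
    change |(s v : ℝ) - g x| ≤ δ
    conv_lhs => rw [← e1]
    refine (abs_projIcc_sub_projIcc _).trans ((?_ : _ ≤ 4 * d).trans hdδ)
    have e2 : (v - d) / (1 - 2 * d) - v = d * (2 * v - 1) / (1 - 2 * d) := by
      rw [eq_div_iff h12.ne', sub_mul, div_mul_cancel₀ _ h12.ne']; ring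
    have e3 : |(v - d) / (1 - 2 * d) - v| ≤ 3 * d := by
      rw [e2, abs_le, le_div_iff₀ h12, div_le_iff₀ h12]
      have : v ≤ 5 / 4 := by linarith [hgx.2]
      have : -(1 / 4) ≤ v := by linarith [hgx.1]
      constructor <;> nlinarith
    calc _ = |((v - d) / (1 - 2 * d) - v) + (v - g x)| := by congr 1; ring
      _ ≤ _ := (abs_add_le _ _).trans (by linarith [(hh' x).le])


/-! ### Inverse limits from approximately commuting maps -/

instance {P : ℕ → Type*} [∀ n, TopologicalSpace (P n)] [∀ n, T2Space (P n)]
    (f : ∀ n, C(P (n + 1), P n)) : T2Space (InverseLimit P f) :=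
  inferInstanceAs (T2Space {x : ∀ n, P n // ∀ n, f n (x (n + 1)) = x n})

/-- The composite `f n ∘ ⋯ ∘ f (n + k - 1)` of bonding maps. -/
def bondingComp {P : Type*} [TopologicalSpace P] (f : ℕ → C(P, P)) (n : ℕ) : ℕ → C(P, P)
  | 0 => ContinuousMap.id P
  | k + 1 => (bondingComp f n k).comp (f (n + k))

lemma bondingComp_succ_left {P : Type*} [TopologicalSpace P] (f : ℕ → C(P, P)) (n k : ℕ) :
    bondingComp f n (k + 1) = (f n).comp (bondingComp f (n + 1) k) := by
  induction k with
  | zero => ext; rfl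
  | succ k ih =>
    rw [bondingComp, ih, bondingComp, show n + 1 + k = n + (k + 1) by omega]
    rfl

lemma bondingComp_surjective {P : Type*} [TopologicalSpace P] {f : ℕ → C(P, P)}
    (hf : ∀ n, Function.Surjective (f n)) (n k : ℕ) :
    Function.Surjective (bondingComp f n k) := by
  induction k with
  | zero => exact Function.surjective_id
  | succ k ih => exact ih.comp (hf _)

/-- A sequence of surjections that commute with the bonding maps up to rapidly decreasing errors,
measured by `ρ`, and that are finer and finer exhibits its domain as the inverse limit. -/
lemma nonempty_homeomorph_inverseLimit_of_approx {X P : Type*} [MetricSpace X] [CompactSpace X]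
    [MetricSpace P] [CompactSpace P] (g : ℕ → C(X, P)) (ρ : ℕ → P → P → ℝ) (e : ℕ → ℝ)
    (f : ℕ → C(P, P)) (hg : ∀ n, Function.Surjective (g n)) (hf : ∀ n, Function.Surjective (f n))
    (hρ : ∀ n u v, dist u v ≤ ρ n u v)
    (hρf : ∀ n u v, ρ n (f n u) (f n v) ≤ ρ (n + 1) u v)
    (he : ∀ n, e (n + 1) ≤ e n / 2)
    (hclose : ∀ n x, ρ n (f n (g (n + 1) x)) (g n x) ≤ e n)
    (hsep : ∀ n x y, (1 / 2 : ℝ) ^ n ≤ dist x y →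
      4 * e (n + 1) < dist (g (n + 1) x) (g (n + 1) y)) :
    Nonempty (X ≃ₜ InverseLimit (fun _ : ℕ => P) f) := by
  -- `ρ (n + k)` dominates distances after all bonding maps down to level `n`. An error at level `n
  -- + k` thus arrives at level `n` with size at most `e n / 2 ^ k`, and the pushed-down maps `a n
  -- k` converge uniformly.
  have hρH : ∀ n k u v, dist (bondingComp f n k u) (bondingComp f n k v) ≤ ρ (n + k) u v := by
    intro n k
    induction k with
    | zero => exact fun u v => hρ n u v
    | succ k ih => exact fun u v => (ih _ _).trans (hρf (n + k) u v)
  have hek : ∀ n k, e (n + k) ≤ e n / 2 ^ k := by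
    intro n k
    induction k with
    | zero => simp
    | succ k ih =>
      calc e (n + k + 1) ≤ e (n + k) / 2 := he _
        _ ≤ e n / 2 ^ k / 2 := by linarith
        _ = _ := by rw [pow_succ, div_div]
  let a : ℕ → ℕ → X → P := fun n k x => bondingComp f n k (g (n + k) x)
  have ha : ∀ n x k, dist (a n k x) (a n (k + 1) x) ≤ 2 * e n / 2 / 2 ^ k := by
    intro n x k
    rw [dist_comm, mul_div_cancel_left₀ _ (two_ne_zero' ℝ)]
    exact ((hρH n k _ _).trans (hclose (n + k) x)).trans (hek n k)
  have hlim : ∀ n x, ∃ p, Tendsto (fun k => a n k x) atTop (𝓝 p) := fun n x =>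
    cauchySeq_tendsto_of_complete (cauchySeq_of_le_geometric_two (ha n x))
  choose G hG using hlim
  have hGa : ∀ n x k, dist (a n k x) (G n x) ≤ 2 * e n / 2 ^ k := fun n x k =>
    dist_le_of_le_geometric_two_of_tendsto (ha n x) (hG n x) k
  have hto : ∀ n, Tendsto (fun k : ℕ => 2 * e n / 2 ^ k) atTop (𝓝 0) := fun n => by
    simpa [div_eq_mul_inv] using (tendsto_pow_atTop_nhds_zero_of_lt_one (r := (2 : ℝ)⁻¹)
      (by norm_num) (by norm_num)).const_mul (2 * e n)
  have hGc : ∀ n, Continuous (G n) := by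
    intro n
    refine TendstoUniformly.continuous (F := a n) (p := atTop) ?_
      (Eventually.of_forall fun k => (bondingComp f n k).continuous.comp (g (n + k)).continuous).frequently
    rw [Metric.tendstoUniformly_iff]
    intro ε hε
    filter_upwards [(hto n).eventually_lt_const hε] with k hk x
    rw [dist_comm]
    exact (hGa n x k).trans_lt hk
  have hGf : ∀ n x, f n (G (n + 1) x) = G n x := by
    intro n x
    have h1 := ((f n).continuous.tendsto _).comp (hG (n + 1) x)
    have h2 := (hG n x).comp (tendsto_add_atTop_nat 1)
    refine tendsto_nhds_unique (h1.congr fun k => ?_) h2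
    simp only [Function.comp, a, bondingComp_succ_left, ContinuousMap.comp_apply,
      show n + 1 + k = n + (k + 1) by omega]
  have hGs : ∀ n, Function.Surjective (G n) := by
    intro n p
    have hcl : IsClosed (range (G n)) := (isCompact_range (hGc n)).isClosed
    change p ∈ range (G n)
    rw [← hcl.closure_eq, Metric.mem_closure_iff]
    intro ε hε
    obtain ⟨k, hk⟩ := ((hto n).eventually_lt_const hε).exists
    obtain ⟨x, hx⟩ := (bondingComp_surjective hf n k).comp (hg (n + k)) p
    refine ⟨G n x, ⟨x, rfl⟩, ?_⟩
    rw [← hx]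
    exact (hGa n x k).trans_lt hk
  let Φ : X → InverseLimit (fun _ : ℕ => P) f := fun x => ⟨fun n => G n x, fun n => hGf n x⟩
  have hΦc : Continuous Φ := Continuous.subtype_mk (continuous_pi hGc) _
  have hΦi : Function.Injective Φ := by
    intro x y hxy
    by_contra hne
    obtain ⟨n, hn⟩ := exists_pow_lt_of_lt_one (dist_pos.2 hne) (show (1 / 2 : ℝ) < 1 by norm_num)
    -- `g (n + 1)` is within `2 * e (n + 1)` of its limit `G (n + 1)`, so points separated by more
    -- than `4 * e (n + 1)` stay distinct.
    have h1 := hsep n x y hn.le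
    have h2 : G (n + 1) x = G (n + 1) y := congrFun (congrArg Subtype.val hxy) (n + 1)
    have h3 := hGa (n + 1) x 0
    have h4 := hGa (n + 1) y 0
    rw [← h2, pow_zero, div_one] at h4
    rw [pow_zero, div_one] at h3
    have h5 := dist_triangle_right (a (n + 1) 0 x) (a (n + 1) 0 y) (G (n + 1) x)
    simp only [a, bondingComp, ContinuousMap.id_apply, add_zero] at h3 h4 h5
    linarith
  have hΦs : Function.Surjective Φ := by
    intro z
    have hcl : ∀ n, IsClosed (G n ⁻¹' {z.1 n}) := fun n => isClosed_singleton.preimage (hGc n)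
    obtain ⟨x, hx⟩ := IsCompact.nonempty_iInter_of_sequence_nonempty_isCompact_isClosed
      (fun n => G n ⁻¹' {z.1 n}) (fun n x hx => by
        have hx : G (n + 1) x = z.1 (n + 1) := hx
        change G n x = z.1 n
        rw [← hGf, hx]
        exact z.2 n) (fun n => hGs n (z.1 n)) (hcl 0).isCompact hcl
    exact ⟨x, Subtype.ext (funext fun n => mem_iInter.1 hx n)⟩
  exact ⟨Continuous.homeoOfEquivCompactToT2 (f := Equiv.ofBijective Φ ⟨hΦi, hΦs⟩) hΦc⟩

/-- If every member of a family of maps of `X` onto `P` factors approximately, through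
a self-surjection of `P`, through members of the family with arbitrarily small fibres, then `X` is
the inverse limit of copies of `P` with surjective bonding maps. -/
theorem exists_homeomorph_inverseLimit {X P : Type*} [MetricSpace X] [CompactSpace X]
    [MetricSpace P] [CompactSpace P] (𝒢 : Set C(X, P)) (hne : 𝒢.Nonempty)
    (hsurj : ∀ g ∈ 𝒢, Function.Surjective g)
    (hstep : ∀ g ∈ 𝒢, ∀ ε > 0, ∀ δ > 0, ∃ g' ∈ 𝒢, ∃ h : C(P, P), Function.Surjective h ∧
      (∀ x y, g' x = g' y → dist x y < ε) ∧ ∀ x, dist (h (g' x)) (g x) ≤ δ) :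
    ∃ f : ℕ → C(P, P), (∀ n, Function.Surjective (f n)) ∧
      Nonempty (X ≃ₜ InverseLimit (fun _ : ℕ => P) f) := by
  let S := {s : C(X, P) × (P → P → ℝ) × ℝ // s.1 ∈ 𝒢 ∧ Continuous (fun p : P × P => s.2.1 p.1 p.2) ∧
    (∀ u, s.2.1 u u = 0) ∧ (∀ u v, dist u v ≤ s.2.1 u v) ∧ 0 < s.2.2}
  have hnext : ∀ (s : S) (n : ℕ), ∃ (s' : S) (h : C(P, P)), Function.Surjective h ∧
      (∀ u v, s.1.2.1 (h u) (h v) ≤ s'.1.2.1 u v) ∧ s'.1.2.2 ≤ s.1.2.2 / 2 ∧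
      (∀ x, s.1.2.1 (h (s'.1.1 x)) (s.1.1 x) ≤ s.1.2.2) ∧
      ∀ x y, (1 / 2 : ℝ) ^ n ≤ dist x y → 4 * s'.1.2.2 < dist (s'.1.1 x) (s'.1.1 y) := by
    rintro ⟨⟨g, ρ, e⟩, hg, hρc, hρ0, hρd, he⟩ n
    obtain ⟨δ, hδ, hρδ⟩ := Metric.uniformContinuous_iff.1
      (CompactSpace.uniformContinuous_of_continuous hρc) e he
    obtain ⟨g', hg', h, hh, hg'ε, hhg⟩ := hstep g hg ((1 / 2) ^ n) (by positivity) (δ / 2)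
      (half_pos hδ)
    obtain ⟨η, hη, hη'⟩ := exists_pos_forall_le_dist g'.continuous hg'ε
    -- The maximum dominates both the distance and the old `ρ` pulled back along `h`. Bounding the
    -- error by `η / 5` leaves `4 * e < η`.
    refine ⟨⟨⟨g', fun u v => max (dist u v) (ρ (h u) (h v)), min (e / 2) (η / 5)⟩, hg', ?_, ?_,
      fun u v => le_max_left _ _, lt_min (half_pos he) (by positivity)⟩, h, hh,
      fun u v => le_max_right _ _, min_le_left _ _, fun x => ?_, fun x y hxy => ?_⟩
    · exact continuous_dist.max (hρc.comp (f := fun p : P × P => (h p.1, h p.2)) (by fun_prop))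
    · intro u
      simp only at hρ0
      simp [hρ0]
    · have hlt : dist (h (g' x), g x) (g x, g x) < δ := by
        rw [Prod.dist_eq, dist_self, max_eq_left dist_nonneg]
        exact (hhg x).trans_lt (half_lt_self hδ)
      have := hρδ hlt
      simp only at this hρ0 ⊢
      rw [hρ0, Real.dist_eq, sub_zero] at this
      exact (le_abs_self _).trans this.le
    · have h1 := hη' x y hxy
      have h2 := min_le_right (e / 2) (η / 5)
      simp only
      linarith
  choose nxt h hh hρ he hclose hsep using hnext
  obtain ⟨g₀, hg₀⟩ := hne
  let s₀ : S := ⟨⟨g₀, dist, 1⟩, hg₀, continuous_dist, dist_self, fun _ _ => le_rfl, one_pos⟩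
  let s : ℕ → S := fun n => Nat.rec s₀ (fun n s => nxt s n) n
  refine ⟨fun n => h (s n) n, fun n => hh _ _, ?_⟩
  exact nonempty_homeomorph_inverseLimit_of_approx (fun n => (s n).1.1) (fun n => (s n).1.2.1)
    (fun n => (s n).1.2.2) (fun n => h (s n) n) (fun n => hsurj _ (s n).2.1) (fun n => hh _ _)
    (fun n => (s n).2.2.2.2.1) (fun n => hρ (s n) n) (fun n => he (s n) n)
    (fun n => hclose (s n) n) (fun n => hsep (s n) n)


/-! ### Trees are dendrites -/

instance : LocallyConnectedSpace unitInterval := by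
  refine locallyConnectedSpace_of_connected_bases (fun x r => Metric.ball x r) (fun _ r => 0 < r)
    (fun x => Metric.nhds_basis_ball) fun x r _ => OrdConnected.isPreconnected ⟨?_⟩
  intro a ha b hb c hc
  rw [Metric.mem_ball, Subtype.dist_eq, Real.dist_eq, abs_lt] at ha hb ⊢
  have h1 : (a : ℝ) ≤ c := hc.1
  have h2 : (c : ℝ) ≤ b := hc.2
  constructor <;> linarith

/-- A component of an open set has open preimages in the pieces `Y i`. Its complement is then a
finite union of compact images, hence closed. -/
lemma locallyConnectedSpace_of_iUnion_range {ι T : Type*} [Finite ι] [TopologicalSpace T]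
    [T2Space T] {Y : ι → Type*} [∀ i, TopologicalSpace (Y i)] [∀ i, CompactSpace (Y i)]
    [∀ i, LocallyConnectedSpace (Y i)] {γ : ∀ i, Y i → T} (hγ : ∀ i, Continuous (γ i))
    (hu : ⋃ i, range (γ i) = univ) : LocallyConnectedSpace T := by
  rw [locallyConnectedSpace_iff_connectedComponentIn_open]
  intro F hF x _
  have hpre : ∀ i, IsOpen (γ i ⁻¹' connectedComponentIn F x) := by
    intro i
    rw [isOpen_iff_mem_nhds]
    intro s hs
    have hsF : γ i ⁻¹' F ∈ 𝓝 s :=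
      (hF.preimage (hγ i)).mem_nhds (connectedComponentIn_subset F x hs)
    refine mem_of_superset (connectedComponentIn_mem_nhds hsF) (image_subset_iff.1 ?_)
    rw [connectedComponentIn_eq hs]
    refine (isPreconnected_connectedComponentIn.image _ (hγ i).continuousOn).subset_connectedComponentIn
      ⟨s, mem_connectedComponentIn (mem_of_mem_nhds hsF), rfl⟩ ?_
    exact image_subset_iff.2 (connectedComponentIn_subset _ _)
  have hcompl : (connectedComponentIn F x)ᶜ =
      ⋃ i, γ i '' (γ i ⁻¹' connectedComponentIn F x)ᶜ := by
    ext y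
    simp only [mem_iUnion, mem_image, mem_compl_iff, mem_preimage]
    constructor
    · intro hy
      obtain ⟨i, s, rfl⟩ := mem_iUnion.1 (hu.ge (mem_univ y))
      exact ⟨i, s, hy, rfl⟩
    · rintro ⟨i, s, hs, rfl⟩
      exact hs
  rw [← isClosed_compl_iff, hcompl]
  exact isClosed_iUnion_of_finite fun i =>
    ((hpre i).isClosed_compl.isCompact.image (hγ i)).isClosed

theorem IsTopologicalTree.isDendrite {T : Type*} [MetricSpace T] (h : IsTopologicalTree T) :
    IsDendrite T := by
  obtain ⟨n, γ, hγ, hu, -⟩ := h.graph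
  refine ⟨⟨?_⟩, h.connected, locallyConnectedSpace_of_iUnion_range (fun i => (hγ i).1) hu,
    h.acyclic⟩
  rw [← hu]
  exact isCompact_iUnion fun i => isCompact_range (hγ i).1

theorem IsTopologicalTree.nontrivial {T : Type*} [MetricSpace T] (h : IsTopologicalTree T) :
    Nontrivial T := by
  obtain ⟨n, γ, hγ, hu, -⟩ := h.graph
  have := h.connected
  obtain ⟨x⟩ := (inferInstance : Nonempty T)
  obtain ⟨i, -⟩ := mem_iUnion.1 (hu.ge (mem_univ x))
  exact ⟨γ i 0, γ i 1, fun he => zero_ne_one ((hγ i).2 he)⟩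

/-! ### From the interval to dendrites -/

/-- A nondegenerate dendrite maps onto the interval so that this map has approximate right inverses
that are onto the dendrite. -/
theorem IsDendrite.exists_approx_sections {D : Type*} [MetricSpace D] [Nontrivial D]
    (h : IsDendrite D) : ∃ φ : C(D, unitInterval), Function.Surjective φ ∧
      ∀ δ > 0, ∃ f : C(unitInterval, D), Function.Surjective f ∧ ∀ t, dist (φ (f t)) t ≤ δ := by
  have := h.compact
  have := h.locallyConnected
  obtain ⟨α, φ, hαφ⟩ := h.exists_isArcRetraction
  refine ⟨⟨fun x => ⟨φ x, hαφ.mem_Icc x⟩, hαφ.continuous.subtype_mk _⟩,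
    fun t => ⟨α t, Subtype.ext (hαφ.apply_arc t t.2)⟩, fun δ hδ => ?_⟩
  obtain ⟨f, hf, hfφ, hfu⟩ := hαφ.exists_filling hδ
  refine ⟨⟨fun t => f t, hf.comp continuous_subtype_val⟩, fun x => ?_, fun t => hfφ t t.2⟩
  obtain ⟨t, ht, htx⟩ := hfu.ge (mem_univ x)
  exact ⟨⟨t, ht⟩, htx⟩

/-- An approximate section of small error does not enlarge the fibres much. -/
lemma exists_pos_forall_section_comp_fiber {X D : Type*} [MetricSpace X] [CompactSpace X]
    {g : X → unitInterval} (hg : Continuous g) {ε : ℝ} (hgε : ∀ x y, g x = g y → dist x y < ε)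
    (φ : D → unitInterval) :
    ∃ δ > 0, ∀ f : unitInterval → D, (∀ t, dist (φ (f t)) t ≤ δ) →
      ∀ x y, f (g x) = f (g y) → dist x y < ε := by
  obtain ⟨η, hη, hgη⟩ := exists_pos_forall_le_dist hg hgε
  refine ⟨η / 3, by positivity, fun f hf x y hxy => not_le.1 fun hle => ?_⟩
  have h1 := hf (g x)
  have h2 := hf (g y)
  rw [hxy] at h1
  linarith [dist_triangle_left (g x) (g y) (φ (f (g y))), hgη x y hle]

theorem IsChainable.exists_epsMapping_dendrite {X D : Type*} [MetricSpace X] [CompactSpace X]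
    [ConnectedSpace X] [Nontrivial X] (hX : IsChainable X) [MetricSpace D] [Nontrivial D]
    (hD : IsDendrite D) {ε : ℝ} (hε : 0 < ε) :
    ∃ f : X → D, IsEpsMapping ε f ∧ Function.Surjective f := by
  obtain ⟨φ, -, hφ⟩ := hD.exists_approx_sections
  -- The diameter is a supremum, so pointwise strict bounds only give `≤`; hence `ε / 2`.
  obtain ⟨g, hg, hgε⟩ := hX.exists_epsMapping_unitInterval (half_pos hε)
  obtain ⟨δ, hδ, hδ'⟩ := exists_pos_forall_section_comp_fiber g.continuous hgε φ
  obtain ⟨f, hf, hfφ⟩ := hφ δ hδ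
  refine ⟨f ∘ g, ⟨f.continuous.comp g.continuous, fun y => ?_⟩, hf.comp hg⟩
  refine (Metric.diam_le_of_forall_dist_le (half_pos hε).le fun a ha b hb => ?_).trans_lt
    (half_lt_self hε)
  exact (hδ' f hfφ a b ((mem_singleton_iff.1 ha).trans (mem_singleton_iff.1 hb).symm)).le

theorem IsChainable.exists_homeomorph_inverseLimit_dendrite {X D : Type*} [MetricSpace X]
    [CompactSpace X] [ConnectedSpace X] [Nontrivial X] (hX : IsChainable X) [MetricSpace D]
    [Nontrivial D] (hD : IsDendrite D) :
    ∃ f : ℕ → C(D, D), (∀ n, Function.Surjective (f n)) ∧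
      Nonempty (X ≃ₜ InverseLimit (fun _ : ℕ => D) f) := by
  have := hD.compact
  obtain ⟨φ, hφs, hφ⟩ := hD.exists_approx_sections
  refine exists_homeomorph_inverseLimit
    {G | ∃ (g : C(X, unitInterval)) (f : C(unitInterval, D)), Function.Surjective g ∧
      Function.Surjective f ∧ G = f.comp g} ?_ ?_ ?_
  · obtain ⟨g, hg, -⟩ := hX.exists_epsMapping_unitInterval one_pos
    obtain ⟨f, hf, -⟩ := hφ 1 one_pos
    exact ⟨_, g, f, hg, hf, rfl⟩
  · rintro _ ⟨g, f, hg, hf, rfl⟩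
    exact hf.comp hg
  rintro _ ⟨g, f, hg, hf, rfl⟩ ε hε δ hδ
  -- Order of choices: `f` fixes `δ₁`, the factorization of `g` fixes `ε₁`, then come `g'` and `h₀`.
  -- Only afterwards is `f'` chosen, so good a section that `h₀` does not notice its error and the
  -- fibres of `f' ∘ g'` stay small.
  obtain ⟨δ₁, hδ₁, hfδ⟩ := Metric.uniformContinuous_iff.1
    (CompactSpace.uniformContinuous_of_continuous f.continuous) δ hδ
  obtain ⟨ε₁, hε₁, hfac⟩ := exists_approx_factorization g hg (show 0 < δ₁ / 3 by positivity)
  obtain ⟨g', hg', hg'ε⟩ := hX.exists_epsMapping_unitInterval (lt_min hε hε₁)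
  obtain ⟨h₀, hh₀, hh₀g⟩ := hfac g' hg' fun x y hxy => (hg'ε x y hxy).trans_le (min_le_right _ _)
  obtain ⟨δ₂, hδ₂, hh₀δ⟩ := Metric.uniformContinuous_iff.1
    (CompactSpace.uniformContinuous_of_continuous h₀.continuous) (δ₁ / 3) (by positivity)
  obtain ⟨δ₃, hδ₃, hfib⟩ := exists_pos_forall_section_comp_fiber g'.continuous hg'ε φ
  obtain ⟨f', hf', hf'φ⟩ := hφ (min (δ₂ / 2) δ₃) (lt_min (half_pos hδ₂) hδ₃)
  refine ⟨f'.comp g', ⟨g', f', hg', hf', rfl⟩, f.comp (h₀.comp φ), hf.comp (hh₀.comp hφs),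
    fun x y hxy => ?_, fun x => ?_⟩
  · exact (hfib f' (fun t => (hf'φ t).trans (min_le_right _ _)) x y hxy).trans_le (min_le_left _ _)
  · refine (hfδ (a := h₀ (φ (f' (g' x)))) (b := g x) ?_).le
    have h1 : dist (φ (f' (g' x))) (g' x) < δ₂ :=
      ((hf'φ _).trans (min_le_left _ _)).trans_lt (half_lt_self hδ₂)
    linarith [dist_triangle (h₀ (φ (f' (g' x)))) (h₀ (g' x)) (g x), hh₀δ h1, hh₀g x]

end Continua

theorem mainTheorem3 (X : Type u) [MetricSpace X] [CompactSpace X] [ConnectedSpace X]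
    [Nontrivial X] (hX : Continua.IsChainable X) :
    (∀ (D : Type v) [MetricSpace D] [Nontrivial D], Continua.IsDendrite D →
      ∀ ε : ℝ, 0 < ε →
        ∃ f : X → D, Continua.IsEpsMapping ε f ∧ Function.Surjective f) ∧
    (∀ (T : Type w) [MetricSpace T], Continua.IsTopologicalTree T →
      ∃ f : ℕ → C(T, T), (∀ n, Function.Surjective (f n)) ∧
        Nonempty (X ≃ₜ Continua.InverseLimit (fun _ : ℕ => T) f)) := by
  refine ⟨fun D _ _ hD ε hε => hX.exists_epsMapping_dendrite hD hε, fun T _ hT => ?_⟩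
  have := hT.nontrivial
  exact hX.exists_homeomorph_inverseLimit_dendrite hT.isDendrite
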